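/- **Intersection model.** Let $G=(V,E)$ be a directed graph of collision points with edge lengths $d(u,v)>0$, with disjoint sets of entry lanes and exit lanes in $V$, and let $a_1,\dots,a_M$ be finitely many agents. Agent $a_i$ has a length $L_i>0$, an earliest start time $e_i\ge 0$, and a predefined simple path $c_i^0,\dots,c_i^{m_i}$ in $G$ from an entry lane to an exit lane; $d_i^q$ is the travel distance from $c_i^0$ to $c_i^q$. Let $\omega>0$, $K\ge 1$, and let $\underline U_i^k,\overline U_i^k$ ($1\le k\le K$) be constants with $0<\underline U_i^1\le\overline U_i^1$ and $\underline U_i^k\le 0\le\overline U_i^k$ for $k\ge 2$. A trajectory of $a_i$ consists of an entry time $s_i\ge e_i$ (before which it waits in front of its entry lane), an arrival time $T_i>s_i$ and a $K$ times continuously differentiable travelled distance $\ell_i$ on $[s_i,T_i]$ with $\ell_i(s_i)=0$, $\ell_i(T_i)=d_i^{m_i}$, $\underline U_i^k\le \ell_i^{(k)}\le\overline U_i^k$ for $1\le k\le K$, $\ell_i'(s_i)=\underline U_i^1$ and $\ell_i^{(k)}(s_i)=0$ for $2\le k\le K$; after $T_i$ the agent keeps its speed. It reaches $c_i^q$ at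 the first time $t_i(c_i^q)$ at which $\ell_i\ge d_i^q$, and occupies it until $t_i(c_i^q)+\tau_i(c_i^q)$, which is $L_i/\omega$ after the first time at which $\ell_i\ge d_i^q+L_i$. Agents $a_i\ne a_j$ collide if for a common collision point $c$ the intervals $[t_i(c),t_i(c)+\tau_i(c))$ and $[t_j(c),t_j(c)+\tau_j(c))$ overlap. If $a_i,a_j$ have the same entry lane and $e_i<e_j$, an overtake happens if $t_i(c)\ge t_j(c)$ for some common collision point $c$. A solution is a family of trajectories, one for each agent, without collisions and overtakes. **The planner PSB.** *Level 1 (priority-based search).* Depth-first search of a binary priority tree. A node holds priority orderings and trajectories. The orderings of the root put $a_i$ before $a_j$ whenever they have the same entry lane and $e_i<e_j$. To generate a node, Level 2 is called for the agents one after the other, each after all agents of higher priority (in the transitive closure of the orderings); the node is discarded if Level 2 fails or if the orderings are cyclic. If the trajectories of the visited node are free of collisions, they are returned; otherwise some colliding pair $a_i,a_j$ is chosen, and two children are generated, with the additional ordering of $a_i$ before $a_j$ and of $a_j$ before $a_i$ respectively. *Level 2 (extended SIPP).* The safe intervals of $a_i$ at a collision point $c$ of its path are what remains of $[e_i,\infty)$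 after the removal of $[t_j(c),t_j(c)+\tau_j(c))$ for each $a_j$ of higher priority, and of all times before $t_j(c)+\tau_j(c)$ if moreover $a_j$ has the same entry lane and $e_j<e_i$. A search node consists of intervals for $c_i^0,\dots,c_i^q$; initially there is one node for each safe interval at $c_i^0$. A node whose last interval is $[lb,ub)$ is expanded by the nonempty intersections of $[lb+d/\overline U_i^1,\,ub+d/\underline U_i^1)$, $d=d(c_i^q,c_i^{q+1})$, with the safe intervals at $c_i^{q+1}$. Always an open node of least value $f=lb+(d_i^{m_i}-d_i^q)/\overline U_i^1$ is taken; for a node at the goal, Level 3 is called, and its result is kept if it arrives earlier than the best one so far. The search ends when no open node has an $f$ smaller than the best arrival time. *Level 3 (BCP).* Given intervals $[lb^j,ub^j)$ for $j=0,\dots,m_i$ and an arrival time $T$, let $\delta_T^*$ be the infimum of the slack $\delta\ge 0$ over all $s<T$ and all Bézier curves $B$ of degree $n$ on $[s,T]$, continued after $T$ with constant speed and by $0$ before $s$, with nondecreasing control points, $B(s)=0$, $B(T)=d_i^{m_i}$, initial derivatives as above, $B(lb^j)\le d_i^j+\delta$ for all $j$, $B(ub^j-L_i/\omega)>d_i^j+L_i-\delta$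 for all $j$ with $ub^j<\infty$, and all control points of the $k$-th derivative in $[\underline U_i^k-\delta,\overline U_i^k+\delta]$ for $1\le k\le K$. Put $\nabla\delta_T^*=(\delta_{T+\Delta}^*-\delta_T^*)/\Delta$. Start with $T_{lb}=lb^{m_i}$, and with $T_{ub}=ub^{m_i}$ if this is finite and $T_{ub}=\max_{j}(lb^j-d_i^j/\underline U_i^1)+(d_i^{m_i}+L_i)/\underline U_i^1$ otherwise. Fail unless $\nabla\delta^*_{T_{lb}}\le 0\le\nabla\delta^*_{T_{ub}}$. While $T_{ub}-T_{lb}>\epsilon$, let $T_{mid}$ be the midpoint: if a curve with arrival time $T_{mid}$ and slack $0$ exists, keep one and set $T_{ub}=T_{mid}$; otherwise set $T_{ub}=T_{mid}$ if $\nabla\delta^*_{T_{mid}}>0$, and $T_{lb}=T_{mid}$ if not. Return the last curve kept, or fail if there is none. **Theorem 2 (Completeness and suboptimality of PSB).** Let $n\ge 1$, $\Delta>0$ and $0<\epsilon<L_i/\underline U_i^1$ for all $i$. On every instance of the intersection model, and whatever choices are made where the description leaves them open (order of the agents and of sibling nodes, colliding pairs, ties, Bézier curves of slack $0$), PSB stops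 after finitely many steps and returns a solution, i.e. kinodynamically feasible trajectories of all agents without collisions and overtakes. Here a step is an elementary step of one of the three levels, in which the optimization problems of Level 3 count as solved exactly. The solution need not be optimal. -/

import Mathlib

namespace PSB

noncomputable section

/-! ### The intersection model -/

/-- An intersection with a family `ι` of agents, and bounds on the derivatives of the travelled
distance up to order `K`. -/
structure Intersection (V ι : Type*) (K : ℕ) where
  /-- the directed graph on the collision points -/
  graph : Digraph V
  /-- the travel distance along an edge -/
  edgeDist : V → V → ℝ
  edgeDist_pos : ∀ u v, graph.Adj u v → 0 < edgeDist u v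
  entryLanes : Set V
  exitLanes : Set V
  lanes_disjoint : Disjoint entryLanes exitLanes
  /-- the predefined path of agent `i` is `path i 0, …, path i (len i)` -/
  len : ι → ℕ
  path : ι → ℕ → V
  path_adj : ∀ i q, q < len i → graph.Adj (path i q) (path i (q + 1))
  /-- a path visits a collision point at most once, so that there is one time of reaching it -/
  path_simple : ∀ i, Set.InjOn (path i) (Set.Iic (len i))
  path_start : ∀ i, path i 0 ∈ entryLanes
  path_goal : ∀ i, path i (len i) ∈ exitLanes
  /-- the length of the agent -/
  length : ι → ℝ
  length_pos : ∀ i, 0 < length i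
  /-- the earliest start time of the agent -/
  earliest : ι → ℝ
  earliest_nonneg : ∀ i, 0 ≤ earliest i
  /-- bounds for the `k`-th derivative of the travelled distance, `1 ≤ k ≤ K` -/
  lo : ι → ℕ → ℝ
  hi : ι → ℕ → ℝ
  order_pos : 1 ≤ K
  minSpeed_pos : ∀ i, 0 < lo i 1
  speed_le : ∀ i, lo i 1 ≤ hi i 1
  higher_bounds : ∀ i k, 2 ≤ k → k ≤ K → lo i k ≤ 0 ∧ 0 ≤ hi i k
  /-- the constant derived from the wave speed -/
  waveSpeed : ℝ
  waveSpeed_pos : 0 < waveSpeed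

/-- A spatio-temporal profile along a given path: the agent waits before its entry lane until time
`start`, has travelled the distance `dist t` at each time `t` of `[start, arrival]`, and reaches
its goal at time `arrival`. -/
structure Profile where
  start : ℝ
  arrival : ℝ
  dist : ℝ → ℝ

/-- Position of the front of the agent at time `t`. Beyond its goal the agent keeps the speed
that it has on arrival, until its whole length has left the intersection. -/
def Profile.pos (P : Profile) (t : ℝ) : ℝ :=
  if t < P.start then 0
  else if t ≤ P.arrival then P.dist t
  else P.dist P.arrival +
    derivWithin P.dist (Set.Icc P.start P.arrival) P.arrival * (t - P.arrival)

namespace Intersection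

variable {V ι : Type*} {K : ℕ} (I : Intersection V ι K)

/-- Travel distance from the start to the `q`-th collision point of the path of agent `i`. -/
def travel (i : ι) (q : ℕ) : ℝ :=
  ∑ r ∈ Finset.range q, I.edgeDist (I.path i r) (I.path i (r + 1))

/-- Travel distance from the start to the goal. -/
def total (i : ι) : ℝ := I.travel i (I.len i)

/-- Initial derivatives: an agent enters at its minimum speed, all higher derivatives being 0. -/
def initial (i : ι) (k : ℕ) : ℝ := if k = 1 then I.lo i 1 else 0

/-- The time at which agent `i` reaches the `q`-th collision point of its path. -/
def reach (i : ι) (P : Profile) (q : ℕ) : ℝ :=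
  sInf {t | P.start ≤ t ∧ I.travel i q ≤ P.pos t}

/-- The time from which on the `q`-th collision point of its path is no longer occupied by agent
`i`: its rear has passed the point, and the time `L / ω` has elapsed since. -/
def leave (i : ι) (P : Profile) (q : ℕ) : ℝ :=
  sInf {t | P.start ≤ t ∧ I.travel i q + I.length i ≤ P.pos t} + I.length i / I.waveSpeed

/-- `P` satisfies the kinodynamic constraints of agent `i` and takes it from its start, not
earlier than its earliest start time, to its goal. -/
structure IsKinodynamic (i : ι) (P : Profile) : Prop where
  earliest_le : I.earliest i ≤ P.start
  start_lt : P.start < P.arrival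
  dist_start : P.dist P.start = 0
  dist_arrival : P.dist P.arrival = I.total i
  contDiff : ContDiffOn ℝ K P.dist (Set.Icc P.start P.arrival)
  initial : ∀ k, 1 ≤ k → k ≤ K →
    iteratedDerivWithin k P.dist (Set.Icc P.start P.arrival) P.start = I.initial i k
  bounds : ∀ k, 1 ≤ k → k ≤ K → ∀ t ∈ Set.Icc P.start P.arrival,
    I.lo i k ≤ iteratedDerivWithin k P.dist (Set.Icc P.start P.arrival) t ∧
    iteratedDerivWithin k P.dist (Set.Icc P.start P.arrival) t ≤ I.hi i k

/-- Agents `i` and `j` collide: their occupation times of a common collision point overlap. -/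
def Collide (traj : ι → Profile) (i j : ι) : Prop :=
  i ≠ j ∧ ∃ q ≤ I.len i, ∃ r ≤ I.len j, I.path i q = I.path j r ∧
    ¬ Disjoint (Set.Ico (I.reach i (traj i) q) (I.leave i (traj i) q))
      (Set.Ico (I.reach j (traj j) r) (I.leave j (traj j) r))

/-- Agent `i` comes from the same entry lane as agent `j`, with an earlier start time. -/
def Ahead (i j : ι) : Prop :=
  I.path i 0 = I.path j 0 ∧ I.earliest i < I.earliest j

/-- Agent `j` overtakes agent `i`. -/
def Overtake (traj : ι → Profile) (i j : ι) : Prop :=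
  I.Ahead i j ∧ ∃ q ≤ I.len i, ∃ r ≤ I.len j, I.path i q = I.path j r ∧
    I.reach j (traj j) r ≤ I.reach i (traj i) q

/-- Solutions of the motion planning problem on the intersection. -/
structure IsSolution (traj : ι → Profile) : Prop where
  kinodynamic : ∀ i, I.IsKinodynamic i (traj i)
  collisionFree : ∀ i j, ¬ I.Collide traj i j
  overtakeFree : ∀ i j, ¬ I.Overtake traj i j

end Intersection

/-! ### Level 3: the Bézier-curve-based planner -/

/-- The Bézier curve of degree `n` on `[0, D]` with control points `p 0, …, p n`. -/
def bezier (n : ℕ) (D : ℝ) (p : ℕ → ℝ) (x : ℝ) : ℝ :=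
  ∑ r ∈ Finset.range (n + 1), p r * ((n.choose r : ℝ) * (x / D) ^ r * ((D - x) / D) ^ (n - r))

/-- The `r`-th control point of the `k`-th derivative of `bezier n D p` (for `r + k ≤ n`). -/
def ctrl (n : ℕ) (D : ℝ) (p : ℕ → ℝ) (k r : ℕ) : ℝ :=
  (n.descFactorial k : ℝ) / D ^ k *
    ∑ j ∈ Finset.range (k + 1), (-1) ^ j * (k.choose j : ℝ) * p (r + k - j)

/-- Enter at time `s`, then follow the Bézier curve with control points `p` until time `T`. -/
def bezierProfile (n : ℕ) (p : ℕ → ℝ) (s T : ℝ) : Profile where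
  start := s
  arrival := T
  dist t := bezier n (T - s) p (t - s)

/-- A time interval `[lb, ub)`, where `ub` may be infinite. -/
structure TimeInterval where
  lb : ℝ
  ub : WithTop ℝ

namespace Intersection

variable {V ι : Type*} {K : ℕ} (I : Intersection V ι K)

/-- The constraints of the optimization problem of Level 3 for the arrival time `T`, in the entry
time `s`, the control points `p` and the slack `δ`; the collision point number `j` has to be
passed within the time interval `S j`. For fixed `s` it is a linear program in `p` and `δ`. The
control points do not decrease, as the curve stands for a travelled distance. -/
structure SlackFeasible (n : ℕ) (i : ι) (S : ℕ → TimeInterval) (T s : ℝ) (p : ℕ → ℝ) (δ : ℝ) :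
    Prop where
  slack_nonneg : 0 ≤ δ
  start_lt : s < T
  first : p 0 = 0
  last : p n = I.total i
  initial : ∀ k, 1 ≤ k → k ≤ K → ctrl n (T - s) p k 0 = I.initial i k
  monotone : ∀ r, r < n → p r ≤ p (r + 1)
  not_early : ∀ j ≤ I.len i, (bezierProfile n p s T).pos (S j).lb ≤ I.travel i j + δ
  not_late : ∀ j ≤ I.len i, ∀ u : ℝ, (S j).ub = (u : WithTop ℝ) →
    I.travel i j + I.length i - δ < (bezierProfile n p s T).pos (u - I.length i / I.waveSpeed)
  bounds : ∀ k, 1 ≤ k → k ≤ K → ∀ r, r + k ≤ n →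
    I.lo i k - δ ≤ ctrl n (T - s) p k r ∧ ctrl n (T - s) p k r ≤ I.hi i k + δ

/-- `P` is a Bézier profile with arrival time `T` that is feasible with slack zero. -/
def IsZeroSlack (n : ℕ) (i : ι) (S : ℕ → TimeInterval) (T : ℝ) (P : Profile) : Prop :=
  ∃ s p, P = bezierProfile n p s T ∧ I.SlackFeasible n i S T s p 0

/-- The optimal slack for the arrival time `T`. -/
def optSlack (n : ℕ) (i : ι) (S : ℕ → TimeInterval) (T : ℝ) : ℝ :=
  sInf {δ | ∃ s p, I.SlackFeasible n i S T s p δ}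

/-- The gradient of the optimal slack, as a difference quotient with increment `Δ`. -/
def gradSlack (n : ℕ) (Δ : ℝ) (i : ι) (S : ℕ → TimeInterval) (T : ℝ) : ℝ :=
  (I.optSlack n i S (T + Δ) - I.optSlack n i S T) / Δ

/-- The initial upper bound of the search. If the last interval is unbounded, it is the minimum
of `t + (d + L) / U`, with `d` the length of the path and `U` the minimum speed, over the `t`
such that the agent is nowhere early when it enters at time `t` and keeps its minimum speed. -/
def upperBound (i : ι) (S : ℕ → TimeInterval) : ℝ :=
  match (S (I.len i)).ub with
  | (u : ℝ) => u
  | ⊤ => (Finset.range (I.len i + 1)).sup' Finset.nonempty_range_add_one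
        (fun j => (S j).lb - I.travel i j / I.lo i 1) + (I.total i + I.length i) / I.lo i 1

end Intersection

/-- States of Level 3: initial state, binary search (bounds and best profile so far), result. -/
inductive BCPState where
  | start
  | search (Tlb Tub : ℝ) (best : Option Profile)
  | done (result : Option Profile)

/-- The steps of Level 3, with `n + 1` control points, tolerance `ε` and increment `Δ`, for agent
`i` and the time intervals `S`. -/
inductive BCPStep {V ι : Type*} {K : ℕ} (I : Intersection V ι K) (n : ℕ) (ε Δ : ℝ) (i : ι)
    (S : ℕ → TimeInterval) : BCPState → BCPState → Prop
  | init : I.gradSlack n Δ i S (S (I.len i)).lb ≤ 0 → 0 ≤ I.gradSlack n Δ i S (I.upperBound i S) →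
      BCPStep I n ε Δ i S .start (.search (S (I.len i)).lb (I.upperBound i S) none)
  | noSolution :
      ¬ (I.gradSlack n Δ i S (S (I.len i)).lb ≤ 0 ∧ 0 ≤ I.gradSlack n Δ i S (I.upperBound i S)) →
      BCPStep I n ε Δ i S .start (.done none)
  | feasible (Tlb Tub : ℝ) (best : Option Profile) (P : Profile) : ε < Tub - Tlb →
      I.IsZeroSlack n i S ((Tlb + Tub) / 2) P →
      BCPStep I n ε Δ i S (.search Tlb Tub best) (.search Tlb ((Tlb + Tub) / 2) (some P))
  | left (Tlb Tub : ℝ) (best : Option Profile) : ε < Tub - Tlb →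
      (¬ ∃ P, I.IsZeroSlack n i S ((Tlb + Tub) / 2) P) →
      0 < I.gradSlack n Δ i S ((Tlb + Tub) / 2) →
      BCPStep I n ε Δ i S (.search Tlb Tub best) (.search Tlb ((Tlb + Tub) / 2) best)
  | right (Tlb Tub : ℝ) (best : Option Profile) : ε < Tub - Tlb →
      (¬ ∃ P, I.IsZeroSlack n i S ((Tlb + Tub) / 2) P) →
      I.gradSlack n Δ i S ((Tlb + Tub) / 2) ≤ 0 →
      BCPStep I n ε Δ i S (.search Tlb Tub best) (.search ((Tlb + Tub) / 2) Tub best)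
  | halt (Tlb Tub : ℝ) (best : Option Profile) : Tub - Tlb ≤ ε →
      BCPStep I n ε Δ i S (.search Tlb Tub best) (.done best)

/-! ### Level 2: extended safe interval path planning -/

/-- The nonempty ones of the at most two intervals that remain of `J` without `[b.1, b.2)`. -/
def TimeInterval.remove (J : TimeInterval) (b : ℝ × ℝ) : List TimeInterval :=
  open Classical in
  [⟨J.lb, min J.ub (b.1 : WithTop ℝ)⟩, ⟨max J.lb b.2, J.ub⟩].filter
    (fun J' => (J'.lb : WithTop ℝ) < J'.ub)

/-- A node of the Level 2 search: the collision points with numbers `0, …, depth` of the path,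
where number `j` is to be passed within the time interval `ivl j`. -/
structure SIPPNode where
  depth : ℕ
  ivl : ℕ → TimeInterval

namespace Intersection

variable {V ι : Type*} {K : ℕ} (I : Intersection V ι K)

/-- The time intervals at the `q`-th collision point of agent `i` that are blocked by the agents
whose trajectories are given by `H`. An agent that starts ahead of `i` on the same entry lane
blocks all the time until it leaves the point, as it must not be overtaken. -/
def blocks [Fintype ι] (H : ι → Option Profile) (i : ι) (q : ℕ) : List (ℝ × ℝ) :=
  open Classical in
  (Finset.univ : Finset ι).toList.flatMap fun j =>
    match H j with
    | none => []
    | some P =>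
      ((List.range (I.len j + 1)).filter (fun r => I.path j r = I.path i q)).map fun r =>
        (if I.Ahead j i then min (I.earliest i) (I.reach j P r) else I.reach j P r,
          I.leave j P r)

/-- The safe intervals of agent `i` at the `q`-th collision point of its path. -/
def safeIntervals [Fintype ι] (H : ι → Option Profile) (i : ι) (q : ℕ) : List TimeInterval :=
  (I.blocks H i q).foldl (fun Js b => Js.flatMap (fun J => J.remove b)) [⟨I.earliest i, ⊤⟩]

/-- The lower bound for the arrival time: the lower bound of the last interval plus the minimum
travel time from there to the goal. -/
def fValue (i : ι) (N : SIPPNode) : ℝ :=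
  (N.ivl N.depth).lb + (I.total i - I.travel i N.depth) / I.hi i 1

/-- Move on to the next collision point in its safe interval `J`, with the speed freely adjustable
between its bounds; `none` if `J` cannot be met. -/
def extend (i : ι) (N : SIPPNode) (J : TimeInterval) : Option SIPPNode :=
  open Classical in
  let d := I.edgeDist (I.path i N.depth) (I.path i (N.depth + 1))
  let lb := max J.lb ((N.ivl N.depth).lb + d / I.hi i 1)
  let ub := min J.ub ((N.ivl N.depth).ub + ((d / I.lo i 1 : ℝ) : WithTop ℝ))
  if (lb : WithTop ℝ) < ub then
    some ⟨N.depth + 1, Function.update N.ivl (N.depth + 1) ⟨lb, ub⟩⟩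
  else none

/-- The child nodes of a node. -/
def expand [Fintype ι] (H : ι → Option Profile) (i : ι) (N : SIPPNode) : Multiset SIPPNode :=
  ((I.safeIntervals H i (N.depth + 1)).filterMap (I.extend i N) : List SIPPNode)

end Intersection

/-- The value `x` is smaller than the arrival time of the best profile so far, if there is one. -/
def Improves : Option Profile → ℝ → Prop
  | none, _ => True
  | some P, x => x < P.arrival

/-- The better one of the best profile so far and a result of Level 3. -/
def keepBest (best : Option Profile) : Option Profile → Option Profile
  | none => best
  | some P => open Classical in if Improves best P.arrival then some P else best

/-- States of Level 2: search (open list and best profile so far), call of Level 3 for a goal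
node, result. -/
inductive SIPPState where
  | search (opn : Multiset SIPPNode) (best : Option Profile)
  | level3 (opn : Multiset SIPPNode) (best : Option Profile) (N : SIPPNode) (b : BCPState)
  | done (result : Option Profile)

/-- Initially there is one node for each safe interval at the entry lane. -/
def SIPPState.init {V ι : Type*} {K : ℕ} [Fintype ι] (I : Intersection V ι K)
    (H : ι → Option Profile) (i : ι) : SIPPState :=
  .search (((I.safeIntervals H i 0).map (fun J => (⟨0, fun _ => J⟩ : SIPPNode)) :
    List SIPPNode) : Multiset SIPPNode) none

/-- The steps of Level 2 for agent `i`, where `H` holds the trajectories of the agents of higher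
priority. -/
inductive SIPPStep {V ι : Type*} {K : ℕ} [Fintype ι] (I : Intersection V ι K) (n : ℕ) (ε Δ : ℝ)
    (H : ι → Option Profile) (i : ι) : SIPPState → SIPPState → Prop
  | finish (opn : Multiset SIPPNode) (best : Option Profile) :
      (∀ N ∈ opn, ¬ Improves best (I.fValue i N)) →
      SIPPStep I n ε Δ H i (.search opn best) (.done best)
  | expand (opn : Multiset SIPPNode) (best : Option Profile) (N : SIPPNode) :
      (∀ N' ∈ opn, I.fValue i N ≤ I.fValue i N') → Improves best (I.fValue i N) →
      N.depth < I.len i →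
      SIPPStep I n ε Δ H i (.search (N ::ₘ opn) best) (.search (opn + I.expand H i N) best)
  | call (opn : Multiset SIPPNode) (best : Option Profile) (N : SIPPNode) :
      (∀ N' ∈ opn, I.fValue i N ≤ I.fValue i N') → Improves best (I.fValue i N) →
      N.depth = I.len i →
      SIPPStep I n ε Δ H i (.search (N ::ₘ opn) best) (.level3 opn best N .start)
  | inner (opn : Multiset SIPPNode) (best : Option Profile) (N : SIPPNode) (b b' : BCPState) :
      BCPStep I n ε Δ i N.ivl b b' →
      SIPPStep I n ε Δ H i (.level3 opn best N b) (.level3 opn best N b')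
  | ret (opn : Multiset SIPPNode) (best : Option Profile) (N : SIPPNode) (r : Option Profile) :
      SIPPStep I n ε Δ H i (.level3 opn best N (.done r)) (.search opn (keepBest best r))

/-! ### Level 1: priority-based search -/

/-- A node of the priority tree: priority orderings (`order i j` means that `i` has higher
priority than `j`) and trajectories. -/
structure PTNode (ι : Type*) where
  order : ι → ι → Prop
  traj : ι → Profile

/-- The orderings `o` together with the ordering of `i` before `j`. -/
def addOrder {ι : Type*} (o : ι → ι → Prop) (i j : ι) : ι → ι → Prop :=
  fun a b => o a b ∨ (a = i ∧ b = j)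

/-- The known trajectories of the agents that have higher priority than `i`, directly or through
other agents. -/
def higher {ι : Type*} (o : ι → ι → Prop) (plan : ι → Option Profile) (i : ι) :
    ι → Option Profile :=
  open Classical in fun j => if Relation.TransGen o j i then plan j else none

/-- States of PSB. The depth-first search keeps a stack of nodes. In `siblings`, `ready` are the
new nodes already generated and `todo` the orderings for which a node is still to be generated; in
`plan` and `level2` the node with the orderings `o` is being generated. -/
inductive State (ι : Type*) where
  | search (stack : List (PTNode ι))
  | siblings (stack ready : List (PTNode ι)) (todo : List (ι → ι → Prop))
  | plan (stack ready : List (PTNode ι)) (todo : List (ι → ι → Prop))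
      (o : ι → ι → Prop) (pl : ι → Option Profile)
  | level2 (stack ready : List (PTNode ι)) (todo : List (ι → ι → Prop))
      (o : ι → ι → Prop) (pl : ι → Option Profile) (i : ι) (s : SIPPState)
  | solved (traj : ι → Profile)
  | failed

/-- Initially the root node is to be generated: agents from the same entry lane are ordered by
their earliest start times. -/
def State.init {V ι : Type*} {K : ℕ} (I : Intersection V ι K) : State ι :=
  .siblings [] [] [I.Ahead]

open Classical in
/-- The steps of PSB. -/
inductive Step {V ι : Type*} {K : ℕ} [Fintype ι] (I : Intersection V ι K) (n : ℕ) (ε Δ : ℝ) :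
    State ι → State ι → Prop
  | fail : Step I n ε Δ (.search []) .failed
  | success (N : PTNode ι) (stack : List (PTNode ι)) : (∀ i j, ¬ I.Collide N.traj i j) →
      Step I n ε Δ (.search (N :: stack)) (.solved N.traj)
  | branch (N : PTNode ι) (stack : List (PTNode ι)) (i j : ι) : I.Collide N.traj i j →
      Step I n ε Δ (.search (N :: stack))
        (.siblings stack [] [addOrder N.order i j, addOrder N.order j i])
  | push (stack ready l : List (PTNode ι)) : l.Perm ready →
      Step I n ε Δ (.siblings stack ready []) (.search (l ++ stack))
  | generate (stack ready : List (PTNode ι)) (o : ι → ι → Prop) (todo : List (ι → ι → Prop)) :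
      (∀ i, ¬ Relation.TransGen o i i) →
      Step I n ε Δ (.siblings stack ready (o :: todo)) (.plan stack ready todo o (fun _ => none))
  | cyclic (stack ready : List (PTNode ι)) (o : ι → ι → Prop) (todo : List (ι → ι → Prop)) (i : ι) :
      Relation.TransGen o i i →
      Step I n ε Δ (.siblings stack ready (o :: todo)) (.siblings stack ready todo)
  | call (stack ready : List (PTNode ι)) (todo : List (ι → ι → Prop)) (o : ι → ι → Prop)
      (pl : ι → Option Profile) (i : ι) : pl i = none →
      (∀ j, Relation.TransGen o j i → pl j ≠ none) →
      Step I n ε Δ (.plan stack ready todo o pl)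
        (.level2 stack ready todo o pl i (SIPPState.init I (higher o pl i) i))
  | inner (stack ready : List (PTNode ι)) (todo : List (ι → ι → Prop)) (o : ι → ι → Prop)
      (pl : ι → Option Profile) (i : ι) (s s' : SIPPState) :
      SIPPStep I n ε Δ (higher o pl i) i s s' →
      Step I n ε Δ (.level2 stack ready todo o pl i s) (.level2 stack ready todo o pl i s')
  | planned (stack ready : List (PTNode ι)) (todo : List (ι → ι → Prop)) (o : ι → ι → Prop)
      (pl : ι → Option Profile) (i : ι) (P : Profile) :
      Step I n ε Δ (.level2 stack ready todo o pl i (.done (some P)))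
        (.plan stack ready todo o (Function.update pl i (some P)))
  | discard (stack ready : List (PTNode ι)) (todo : List (ι → ι → Prop)) (o : ι → ι → Prop)
      (pl : ι → Option Profile) (i : ι) :
      Step I n ε Δ (.level2 stack ready todo o pl i (.done none)) (.siblings stack ready todo)
  | generated (stack ready : List (PTNode ι)) (todo : List (ι → ι → Prop)) (o : ι → ι → Prop)
      (traj : ι → Profile) :
      Step I n ε Δ (.plan stack ready todo o (fun i => some (traj i)))
        (.siblings stack (⟨o, traj⟩ :: ready) todo)

end

end PSB

/-! The planner never backtracks: no call of Level 2 made by PSB fails and no generated ordering is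
cyclic, so every branching yields two usable children. The proof combines an invariant
(`Step.good`), the existence of a next step in every unsolved state satisfying it
(`State.exists_step`), and termination (`State.acc_search`).

Level 2 succeeds because finitely many blocked intervals leave an unbounded safe interval at each
collision point. Until a profile is found, a node made of unbounded intervals stays open or is being
handled by Level 3. For such a node nothing can be late, so entering late and keeping the minimum
speed has slack zero for every arrival time from `upperBound - L / U` on, with `L` the length and
`U` the minimum speed (`exists_isZeroSlack`). Delaying any feasible curve keeps it feasible, so the
slack gradient is nowhere positive (`gradSlack_nonpos`). Hence the initial test passes, and an
infeasible midpoint only raises the lower bound, leaving a gap above `L / U > ε`. The bisection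
cannot halt before it has found a curve (`BCPStep.promising`).

What Level 2 returns is valid: Bézier curves stay between the bounds of their control points, and
their occupation times lie in safe intervals (`Fits.valid`). In a node of the priority tree, agents
comparable in the transitive closure therefore do not collide. A colliding pair is incomparable, so
ordering it either way creates no cycle and strictly lowers the number of unordered pairs. Overtakes
are excluded since the root orderings persist.

Termination is nested: the bisection halves its interval, Level 2 decreases the multiset of
remaining depths, planning decreases the number of unplanned agents, and Level 1 decreases the
multiset of numbers of unordered pairs. -/

namespace PSB

/-! ### Bézier curves -/

/-- Gives access to the theory of Bernstein polynomials: values at the endpoints, derivatives and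
first moment. -/
theorem bezier_eq_eval (n : ℕ) {D : ℝ} (hD : D ≠ 0) (p : ℕ → ℝ) (x : ℝ) :
    bezier n D p x = (∑ r ∈ Finset.range (n + 1),
      Polynomial.C (p r) * bernsteinPolynomial ℝ n r).eval (x / D) := by
  have h : (D - x) / D = 1 - x / D := by field_simp
  simp only [bezier, Polynomial.eval_finsetSum, Polynomial.eval_mul, Polynomial.eval_C,
    bernsteinPolynomial, Polynomial.eval_pow, Polynomial.eval_sub, Polynomial.eval_one,
    Polynomial.eval_X, Polynomial.eval_natCast, h]

theorem bezier_zero_left (D : ℝ) (p : ℕ → ℝ) (x : ℝ) : bezier 0 D p x = p 0 := by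
  simp [bezier]

theorem bezier_at_zero (n : ℕ) {D : ℝ} (hD : D ≠ 0) (p : ℕ → ℝ) : bezier n D p 0 = p 0 := by
  rw [bezier_eq_eval n hD, zero_div, Polynomial.eval_finsetSum, Finset.sum_eq_single 0]
  · simp [bernsteinPolynomial.eval_at_0]
  · intro r _ hr
    simp [bernsteinPolynomial.eval_at_0, hr]
  · simp

theorem bezier_at_length (n : ℕ) {D : ℝ} (hD : D ≠ 0) (p : ℕ → ℝ) : bezier n D p D = p n := by
  rw [bezier_eq_eval n hD, div_self hD, Polynomial.eval_finsetSum, Finset.sum_eq_single n]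
  · simp [bernsteinPolynomial.eval_at_1]
  · intro r _ hr
    simp [bernsteinPolynomial.eval_at_1, hr]
  · simp

/-- Convex hull property: by the binomial theorem the weights sum to 1, and on `[0, D]` they are
nonnegative. -/
theorem bezier_le {n : ℕ} {D : ℝ} (hD : 0 < D) {p : ℕ → ℝ} {b x : ℝ} (hx : 0 ≤ x) (hxD : x ≤ D)
    (hp : ∀ r ≤ n, p r ≤ b) : bezier n D p x ≤ b := by
  have hsum : ∑ r ∈ Finset.range (n + 1),
      ((n.choose r : ℝ) * (x / D) ^ r * ((D - x) / D) ^ (n - r)) = 1 := by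
    have h := add_pow (x / D) ((D - x) / D) n
    have h1 : x / D + (D - x) / D = 1 := by field_simp; ring
    rw [h1, one_pow] at h
    rw [h]
    exact Finset.sum_congr rfl fun r _ => by ring
  calc bezier n D p x ≤ ∑ r ∈ Finset.range (n + 1),
      b * ((n.choose r : ℝ) * (x / D) ^ r * ((D - x) / D) ^ (n - r)) := by
        refine Finset.sum_le_sum fun r hr => ?_
        have : 0 ≤ (D - x) / D := div_nonneg (by linarith) hD.le
        exact mul_le_mul_of_nonneg_right (hp r (by simpa [Nat.lt_succ_iff] using hr))
          (by positivity)
    _ = b := by rw [← Finset.mul_sum, hsum, mul_one]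

theorem bezier_neg (n : ℕ) (D : ℝ) (p : ℕ → ℝ) (x : ℝ) :
    bezier n D (fun r => -p r) x = -bezier n D p x := by
  simp [bezier, Finset.sum_neg_distrib]

theorem le_bezier {n : ℕ} {D : ℝ} (hD : 0 < D) {p : ℕ → ℝ} {b x : ℝ} (hx : 0 ≤ x) (hxD : x ≤ D)
    (hp : ∀ r ≤ n, b ≤ p r) : b ≤ bezier n D p x := by
  have := bezier_le (p := fun r => -p r) (b := -b) hD hx hxD fun r hr => neg_le_neg (hp r hr)
  rw [bezier_neg] at this
  linarith

/-! ### Derivatives of Bézier curves and their control points. -/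

theorem derivative_sum_bernstein (m : ℕ) (p : ℕ → ℝ) :
    Polynomial.derivative (∑ r ∈ Finset.range (m + 1 + 1),
      Polynomial.C (p r) * bernsteinPolynomial ℝ (m + 1) r) =
    Polynomial.C ((m + 1 : ℕ) : ℝ) * ∑ r ∈ Finset.range (m + 1),
      Polynomial.C (p (r + 1) - p r) * bernsteinPolynomial ℝ m r := by
  -- Summation by parts: the derivative of each Bernstein polynomial is a difference of two
  -- neighbours of lower degree, and the boundary term of index `m + 1` vanishes.
  have hshift : ∑ r ∈ Finset.range (m + 1),
      Polynomial.C (p (r + 1)) * bernsteinPolynomial ℝ m (r + 1) +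
      Polynomial.C (p 0) * bernsteinPolynomial ℝ m 0 =
      ∑ r ∈ Finset.range (m + 1), Polynomial.C (p r) * bernsteinPolynomial ℝ m r := by
    rw [← Finset.sum_range_succ' (fun r => Polynomial.C (p r) * bernsteinPolynomial ℝ m r),
      Finset.sum_range_succ, bernsteinPolynomial.eq_zero_of_lt ℝ (Nat.lt_succ_self m), mul_zero,
      add_zero]
  have hpull : ∀ f : ℕ → Polynomial ℝ, ∑ r ∈ Finset.range (m + 1),
      Polynomial.C (p (r + 1)) * (((m + 1 : ℕ) : Polynomial ℝ) * f r) =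
      ((m + 1 : ℕ) : Polynomial ℝ) *
        ∑ r ∈ Finset.range (m + 1), Polynomial.C (p (r + 1)) * f r := by
    intro f
    rw [Finset.mul_sum]
    exact Finset.sum_congr rfl fun r _ => mul_left_comm _ _ _
  rw [Finset.sum_range_succ']
  simp only [Polynomial.derivative_add, Polynomial.derivative_sum, Polynomial.derivative_C_mul,
    bernsteinPolynomial.derivative_succ, bernsteinPolynomial.derivative_zero,
    Nat.add_sub_cancel, hpull]
  simp only [Polynomial.C_sub, sub_mul, Finset.sum_sub_distrib, mul_sub, map_natCast]
  linear_combination (-((m + 1 : ℕ) : Polynomial ℝ)) * hshift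

/-- The truncated `n - 1` is harmless at `n = 0`, where the factor `n / D` is zero. -/
theorem hasDerivAt_bezier (n : ℕ) {D : ℝ} (hD : D ≠ 0) (p : ℕ → ℝ) (x : ℝ) :
    HasDerivAt (bezier n D p) (bezier (n - 1) D (fun r => n / D * (p (r + 1) - p r)) x) x := by
  rcases n with _ | m
  · have : bezier 0 D p = fun _ => p 0 := funext fun x => bezier_zero_left D p x
    rw [this]
    simpa [bezier] using hasDerivAt_const x (p 0)
  · have hfun : bezier (m + 1) D p = fun x => (∑ r ∈ Finset.range (m + 1 + 1),
        Polynomial.C (p r) * bernsteinPolynomial ℝ (m + 1) r).eval (x / D) :=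
      funext fun x => bezier_eq_eval _ hD p x
    rw [hfun]
    have h := (Polynomial.hasDerivAt (∑ r ∈ Finset.range (m + 1 + 1),
        Polynomial.C (p r) * bernsteinPolynomial ℝ (m + 1) r) (x / D)).comp x
        ((hasDerivAt_id x).div_const D)
    refine h.congr_deriv ?_
    rw [derivative_sum_bernstein, Nat.add_sub_cancel, bezier_eq_eval m hD]
    simp only [Polynomial.eval_mul, Polynomial.eval_C, Polynomial.eval_finsetSum, Finset.mul_sum,
      Finset.sum_mul]
    exact Finset.sum_congr rfl fun r _ => by ring

/-- The alternating sum is an iterated forward difference, which yields the recursion `ctrl_succ`.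
-/
theorem ctrl_eq_fwdDiff (n : ℕ) (D : ℝ) (p : ℕ → ℝ) (k r : ℕ) :
    ctrl n D p k r = (n.descFactorial k : ℝ) / D ^ k * (fwdDiff 1)^[k] p r := by
  rw [ctrl, fwdDiff_iter_eq_sum_shift, ← Finset.sum_range_reflect]
  congr 1
  refine Finset.sum_congr rfl fun j hj => ?_
  have hj : j ≤ k := by simpa [Nat.lt_succ_iff] using hj
  have h1 : k + 1 - 1 - j = k - j := by omega
  have h2 : r + k - (k - j) = r + j := by omega
  rw [h1, h2, Nat.choose_symm hj]
  simp

theorem ctrl_zero (n : ℕ) (D : ℝ) (p : ℕ → ℝ) : ctrl n D p 0 = p := by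
  ext r
  simp [ctrl_eq_fwdDiff]

theorem ctrl_succ (n : ℕ) (D : ℝ) (p : ℕ → ℝ) (k r : ℕ) :
    ctrl n D p (k + 1) r = ((n - k : ℕ) : ℝ) / D * (ctrl n D p k (r + 1) - ctrl n D p k r) := by
  simp only [ctrl_eq_fwdDiff, Function.iterate_succ_apply', Nat.descFactorial_succ, fwdDiff,
    Nat.cast_mul, pow_succ]
  ring

theorem ctrl_one (n : ℕ) (D : ℝ) (p : ℕ → ℝ) (r : ℕ) :
    ctrl n D p 1 r = n / D * (p (r + 1) - p r) := by
  rw [ctrl_succ, ctrl_zero, Nat.sub_zero]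

theorem ctrl_of_lt {n k : ℕ} (h : n < k) (D : ℝ) (p : ℕ → ℝ) (r : ℕ) : ctrl n D p k r = 0 := by
  rw [ctrl, Nat.descFactorial_eq_zero_iff_lt.2 h]
  simp

theorem hasDerivAt_bezier_ctrl (n k : ℕ) {D : ℝ} (hD : D ≠ 0) (p : ℕ → ℝ) (x : ℝ) :
    HasDerivAt (bezier (n - k) D (ctrl n D p k)) (bezier (n - (k + 1)) D (ctrl n D p (k + 1)) x)
      x := by
  refine (hasDerivAt_bezier (n - k) hD (ctrl n D p k) x).congr_deriv ?_
  have : (fun r => ((n - k : ℕ) : ℝ) / D * (ctrl n D p k (r + 1) - ctrl n D p k r)) =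
      ctrl n D p (k + 1) := funext fun r => (ctrl_succ n D p k r).symm
  rw [this, Nat.sub_sub]

theorem iteratedDeriv_bezier (n k : ℕ) {D : ℝ} (hD : D ≠ 0) (p : ℕ → ℝ) (s : ℝ) :
    iteratedDeriv k (fun t => bezier n D p (t - s)) =
      fun t => bezier (n - k) D (ctrl n D p k) (t - s) := by
  induction k with
  | zero => simp [ctrl_zero]
  | succ k ih =>
    rw [iteratedDeriv_succ, ih]
    ext t
    exact ((hasDerivAt_bezier_ctrl n k hD p (t - s)).comp_sub_const t s).deriv

theorem contDiff_bezier (n : ℕ) (D : ℝ) (p : ℕ → ℝ) (s : ℝ) {N : WithTop ℕ∞} :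
    ContDiff ℝ N (fun t => bezier n D p (t - s)) := by
  unfold bezier
  fun_prop

theorem iteratedDerivWithin_bezier (n k : ℕ) (p : ℕ → ℝ) {s T t : ℝ} (hT : s < T)
    (ht : t ∈ Set.Icc s T) :
    iteratedDerivWithin k (fun t => bezier n (T - s) p (t - s)) (Set.Icc s T) t =
      bezier (n - k) (T - s) (ctrl n (T - s) p k) (t - s) := by
  rw [iteratedDerivWithin_eq_iteratedDeriv (uniqueDiffOn_Icc hT)
    (contDiff_bezier n (T - s) p s).contDiffAt ht, iteratedDeriv_bezier n k (sub_pos.2 hT).ne']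

theorem monotoneOn_bezier {n : ℕ} {D : ℝ} (hD : 0 < D) {p : ℕ → ℝ}
    (hp : ∀ r < n, p r ≤ p (r + 1)) : MonotoneOn (bezier n D p) (Set.Icc 0 D) := by
  rcases n with _ | m
  · intro x _ y _ _
    simp [bezier_zero_left]
  refine monotoneOn_of_hasDerivWithinAt_nonneg (convex_Icc 0 D)
    (fun x _ => (hasDerivAt_bezier _ hD.ne' p x).continuousAt.continuousWithinAt)
    (fun x _ => (hasDerivAt_bezier _ hD.ne' p x).hasDerivWithinAt) ?_
  intro x hx
  rw [interior_Icc] at hx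
  refine le_bezier hD hx.1.le hx.2.le fun r hr => ?_
  exact mul_nonneg (by positivity) (sub_nonneg.2 (hp r (by omega)))

/-- The position along a Bézier profile. -/
theorem bezierProfile_pos (n : ℕ) (p : ℕ → ℝ) {s T : ℝ} (hT : s < T) (t : ℝ) :
    (bezierProfile n p s T).pos t = if t < s then 0
      else if t ≤ T then bezier n (T - s) p (t - s)
      else p n + ctrl n (T - s) p 1 (n - 1) * (t - T) := by
  have hD : T - s ≠ 0 := (sub_pos.2 hT).ne'
  have h := iteratedDerivWithin_bezier n 1 p hT (Set.right_mem_Icc.2 hT.le)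
  rw [iteratedDerivWithin_one, bezier_at_length _ hD] at h
  simp only [Profile.pos, bezierProfile, h, bezier_at_length n hD]

theorem bezierProfile_pos_shift (n : ℕ) (p : ℕ → ℝ) {s T : ℝ} (hT : s < T) (h t : ℝ) :
    (bezierProfile n p (s + h) (T + h)).pos t = (bezierProfile n p s T).pos (t - h) := by
  rw [bezierProfile_pos n p hT, bezierProfile_pos n p (add_lt_add_left hT h)]
  have h1 : T + h - (s + h) = T - s := by ring
  have h2 : t - (s + h) = t - h - s := by ring
  have h3 : t - (T + h) = t - h - T := by ring
  simp only [h1, h2, h3, ← sub_lt_iff_lt_add, ← sub_le_iff_le_add]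

/-- With positive slack the lower speed bound may become negative, so monotonicity has to come from
the order of the control points. -/
theorem monotone_pos_bezierProfile {n : ℕ} (hn : 1 ≤ n) {p : ℕ → ℝ} {s T : ℝ} (hT : s < T)
    (h0 : p 0 = 0) (hp : ∀ r < n, p r ≤ p (r + 1)) : Monotone (bezierProfile n p s T).pos := by
  have hD : 0 < T - s := sub_pos.2 hT
  have hmono := monotoneOn_bezier hD hp
  have hv : 0 ≤ ctrl n (T - s) p 1 (n - 1) := by
    rw [ctrl_one]
    exact mul_nonneg (by positivity) (sub_nonneg.2 (hp _ (by omega)))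
  have hz := bezier_at_zero n hD.ne' p
  have hl := bezier_at_length n hD.ne' p
  intro x y hxy
  have key : ∀ a b, 0 ≤ a → a ≤ b → b ≤ T - s → bezier n (T - s) p a ≤ bezier n (T - s) p b :=
    fun a b ha hab hb => hmono ⟨ha, hab.trans hb⟩ ⟨ha.trans hab, hb⟩ hab
  have hpn : 0 ≤ p n := by
    have := key 0 (T - s) le_rfl hD.le le_rfl
    rwa [hz, hl, h0] at this
  rw [bezierProfile_pos n p hT, bezierProfile_pos n p hT]
  split_ifs with h1 h2 h3 h4 h5 h6 h7 <;> try linarith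
  · rw [← h0, ← hz]
    exact key _ _ le_rfl (by linarith) (by linarith)
  · have := mul_nonneg hv (sub_nonneg.2 (not_le.1 h3).le)
    linarith
  · exact key _ _ (by linarith) (by linarith) (by linarith)
  · have := mul_nonneg hv (sub_nonneg.2 (not_le.1 h6).le)
    have := key (x - s) (T - s) (by linarith) (by linarith) le_rfl
    rw [hl] at this
    linarith
  · have := mul_le_mul_of_nonneg_left (sub_le_sub_right hxy T) hv
    linarith

/-! ### Positions, times of reaching and leaving -/

theorem strictMonoOn_pos {P : Profile} (hlt : P.start < P.arrival)
    (hdiff : DifferentiableOn ℝ P.dist (Set.Icc P.start P.arrival))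
    (hpos : ∀ t ∈ Set.Icc P.start P.arrival,
      0 < derivWithin P.dist (Set.Icc P.start P.arrival) t) :
    StrictMonoOn P.pos (Set.Ici P.start) := by
  have hd : StrictMonoOn P.dist (Set.Icc P.start P.arrival) := by
    refine strictMonoOn_of_hasDerivWithinAt_pos (convex_Icc _ _) hdiff.continuousOn
      (fun x hx => ((hdiff x (interior_subset hx)).hasDerivWithinAt).mono interior_subset)
      fun x hx => hpos x (interior_subset hx)
  have hv := hpos _ (Set.right_mem_Icc.2 hlt.le)
  intro x hx y hy hxy
  rw [Set.mem_Ici] at hx hy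
  simp only [Profile.pos, not_lt.2 hx, not_lt.2 hy, if_false]
  split_ifs with h1 h2 h2
  · exact hd ⟨hx, h1⟩ ⟨hy, h2⟩ hxy
  · have := hd.monotoneOn ⟨hx, h1⟩ (Set.right_mem_Icc.2 hlt.le) h1
    have := mul_pos hv (sub_pos.2 (not_le.1 h2))
    linarith
  · linarith
  · have := mul_lt_mul_of_pos_left (sub_lt_sub_right hxy P.arrival) hv
    linarith

namespace Intersection

variable {V ι : Type*} {K : ℕ} (I : Intersection V ι K)

theorem travel_nonneg {i : ι} {q : ℕ} (hq : q ≤ I.len i) : 0 ≤ I.travel i q :=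
  Finset.sum_nonneg fun r hr =>
    (I.edgeDist_pos _ _ (I.path_adj i r (by have := Finset.mem_range.1 hr; omega))).le

theorem len_pos (i : ι) : 0 < I.len i := by
  refine Nat.pos_of_ne_zero fun h => ?_
  have h1 := I.path_goal i
  rw [h] at h1
  exact Set.disjoint_left.1 I.lanes_disjoint (I.path_start i) h1

theorem total_pos (i : ι) : 0 < I.total i := by
  refine Finset.sum_pos (fun r hr => I.edgeDist_pos _ _ (I.path_adj i r (Finset.mem_range.1 hr))) ?_
  exact Finset.nonempty_range_iff.2 (I.len_pos i).ne'

namespace IsKinodynamic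

variable {I} {i : ι} {P : Profile} (hP : I.IsKinodynamic i P)

include hP

theorem derivWithin_pos {t : ℝ} (ht : t ∈ Set.Icc P.start P.arrival) :
    0 < derivWithin P.dist (Set.Icc P.start P.arrival) t := by
  have := (hP.bounds 1 le_rfl I.order_pos t ht).1
  rw [iteratedDerivWithin_one] at this
  exact (I.minSpeed_pos i).trans_le this

theorem strictMonoOn_pos : StrictMonoOn P.pos (Set.Ici P.start) :=
  PSB.strictMonoOn_pos hP.start_lt
    (hP.contDiff.differentiableOn (by have := I.order_pos; exact_mod_cast (by omega : K ≠ 0)))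
    fun _ ht => hP.derivWithin_pos ht

theorem exists_le_pos (d : ℝ) : ∃ t, P.start ≤ t ∧ d ≤ P.pos t := by
  have hv := hP.derivWithin_pos (Set.right_mem_Icc.2 hP.start_lt.le)
  set v := derivWithin P.dist (Set.Icc P.start P.arrival) P.arrival with hv_def
  have h0 : 0 < |d - P.dist P.arrival| / v + 1 := by positivity
  refine ⟨P.arrival + (|d - P.dist P.arrival| / v + 1), by linarith [hP.start_lt], ?_⟩
  have h1 : ¬ P.arrival + (|d - P.dist P.arrival| / v + 1) < P.start := by
    linarith [hP.start_lt]
  have h2 : ¬ P.arrival + (|d - P.dist P.arrival| / v + 1) ≤ P.arrival := by linarith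
  rw [Profile.pos, if_neg h1, if_neg h2, ← hv_def, add_sub_cancel_left, mul_add,
    mul_div_cancel₀ _ hv.ne']
  have := le_abs_self (d - P.dist P.arrival)
  linarith

theorem reach_lt_leave (q : ℕ) : I.reach i P q < I.leave i P q := by
  have h1 : I.reach i P q ≤ sInf {t | P.start ≤ t ∧ I.travel i q + I.length i ≤ P.pos t} := by
    refine csInf_le_csInf ⟨P.start, fun t ht => ht.1⟩ (hP.exists_le_pos _) fun t ht => ⟨ht.1, ?_⟩
    linarith [ht.2, I.length_pos i]
  have h2 : 0 < I.length i / I.waveSpeed := div_pos (I.length_pos i) I.waveSpeed_pos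
  rw [leave]
  linarith

theorem le_reach {q : ℕ} {b : ℝ} (h : P.pos b ≤ I.travel i q) : b ≤ I.reach i P q := by
  refine le_csInf (hP.exists_le_pos _) fun t ht => ?_
  by_contra hlt
  push Not at hlt
  have := hP.strictMonoOn_pos (Set.mem_Ici.2 ht.1) (Set.mem_Ici.2 (ht.1.trans hlt.le)) hlt
  linarith [ht.2]

end IsKinodynamic

theorem leave_le {i : ι} {P : Profile} {q : ℕ} (hq : q ≤ I.len i) {u : ℝ}
    (h : I.travel i q + I.length i ≤ P.pos (u - I.length i / I.waveSpeed)) :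
    I.leave i P q ≤ u := by
  -- Before the start the position is 0, short of the positive distance required.
  have hs : P.start ≤ u - I.length i / I.waveSpeed := by
    by_contra hlt
    rw [Profile.pos, if_pos (not_le.1 hlt)] at h
    linarith [I.travel_nonneg hq, I.length_pos i]
  have := csInf_le (s := {t | P.start ≤ t ∧ I.travel i q + I.length i ≤ P.pos t})
    ⟨P.start, fun t ht => ht.1⟩ ⟨hs, h⟩
  rw [leave]
  linarith

/-! ### Level 3 -/

theorem IsZeroSlack.isKinodynamic {I : Intersection V ι K} {n : ℕ} (hn : 1 ≤ n) {i : ι}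
    {S : ℕ → TimeInterval} {T : ℝ} {P : Profile} (h : I.IsZeroSlack n i S T P)
    (hS : I.earliest i ≤ (S 0).lb) : I.IsKinodynamic i P := by
  obtain ⟨s, p, rfl, hf⟩ := h
  have hD : 0 < T - s := sub_pos.2 hf.start_lt
  have hcd : ∀ {N : WithTop ℕ∞}, ContDiff ℝ N (bezierProfile n p s T).dist :=
    contDiff_bezier n (T - s) p s
  have hbounds : ∀ k, 1 ≤ k → k ≤ K → ∀ t ∈ Set.Icc s T,
      I.lo i k ≤ iteratedDerivWithin k (bezierProfile n p s T).dist (Set.Icc s T) t ∧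
      iteratedDerivWithin k (bezierProfile n p s T).dist (Set.Icc s T) t ≤ I.hi i k := by
    intro k hk hkK t ht
    have h1 : iteratedDerivWithin k (bezierProfile n p s T).dist (Set.Icc s T) t = _ :=
      iteratedDerivWithin_bezier n k p hf.start_lt ht
    rw [h1]
    have hc : ∀ r ≤ n - k, I.lo i k ≤ ctrl n (T - s) p k r ∧ ctrl n (T - s) p k r ≤ I.hi i k := by
      intro r hr
      rcases le_or_gt k n with hkn | hkn
      · have := hf.bounds k hk hkK r (by omega)
        exact ⟨by linarith [this.1], by linarith [this.2]⟩
      -- Derivatives of order above the degree vanish; here `k ≥ 2`, and 0 is within the bounds.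
      · rw [ctrl_of_lt hkn]
        exact I.higher_bounds i k (by omega) hkK
    exact ⟨le_bezier hD (by linarith [ht.1]) (by linarith [ht.2]) fun r hr => (hc r hr).1,
      bezier_le hD (by linarith [ht.1]) (by linarith [ht.2]) fun r hr => (hc r hr).2⟩
  have hmono : StrictMonoOn (bezierProfile n p s T).pos (Set.Ici s) := by
    refine PSB.strictMonoOn_pos hf.start_lt
      (hcd (N := 1)).differentiable_one.differentiableOn fun t ht => ?_
    have := (hbounds 1 le_rfl I.order_pos t ht).1
    rw [iteratedDerivWithin_one] at this
    exact (I.minSpeed_pos i).trans_le this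
  have hstart : (bezierProfile n p s T).dist s = 0 := by
    simp only [bezierProfile, sub_self]
    rw [bezier_at_zero n hD.ne', hf.first]
  refine ⟨?_, hf.start_lt, hstart, ?_, hcd.contDiffOn, ?_, hbounds⟩
  · refine hS.trans ?_
    -- Entering before the first interval would make the position at its lower end positive, by
    -- strict monotonicity, against `not_early` at `j = 0`.
    by_contra hlt
    have hlt : s < (S 0).lb := not_le.1 hlt
    have h0 := hf.not_early 0 (Nat.zero_le _)
    have h1 := hmono (Set.mem_Ici.2 le_rfl) (Set.mem_Ici.2 hlt.le) hlt
    rw [bezierProfile_pos n p hf.start_lt s, if_neg (lt_irrefl s), if_pos hf.start_lt.le, sub_self,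
      bezier_at_zero n hD.ne', hf.first] at h1
    simp only [travel, Finset.range_zero, Finset.sum_empty] at h0
    linarith
  · exact (bezier_at_length n hD.ne' p).trans hf.last
  · intro k hk hkK
    have h1 : iteratedDerivWithin k (bezierProfile n p s T).dist (Set.Icc s T) s = _ :=
      iteratedDerivWithin_bezier n k p hf.start_lt (Set.left_mem_Icc.2 hf.start_lt.le)
    refine h1.trans ?_
    rw [sub_self, bezier_at_zero _ hD.ne']
    exact hf.initial k hk hkK

theorem IsZeroSlack.le_reach {I : Intersection V ι K} {n : ℕ} (hn : 1 ≤ n) {i : ι}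
    {S : ℕ → TimeInterval} {T : ℝ} {P : Profile} (h : I.IsZeroSlack n i S T P)
    (hS : I.earliest i ≤ (S 0).lb) {q : ℕ} (hq : q ≤ I.len i) : (S q).lb ≤ I.reach i P q := by
  refine (h.isKinodynamic hn hS).le_reach ?_
  obtain ⟨s, p, rfl, hf⟩ := h
  simpa using hf.not_early q hq

theorem IsZeroSlack.leave_le {I : Intersection V ι K} {n : ℕ} {i : ι} {S : ℕ → TimeInterval}
    {T : ℝ} {P : Profile} (h : I.IsZeroSlack n i S T P) {q : ℕ} (hq : q ≤ I.len i) {u : ℝ}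
    (hu : (S q).ub = (u : WithTop ℝ)) : I.leave i P q ≤ u := by
  obtain ⟨s, p, rfl, hf⟩ := h
  refine I.leave_le hq ?_
  simpa using (hf.not_late q hq u hu).le

theorem SlackFeasible.shift {I : Intersection V ι K} {n : ℕ} (hn : 1 ≤ n) {i : ι}
    {S : ℕ → TimeInterval} (hS : ∀ j ≤ I.len i, (S j).ub = ⊤) {T s : ℝ} {p : ℕ → ℝ} {δ : ℝ}
    (hf : I.SlackFeasible n i S T s p δ) {h : ℝ} (hh : 0 ≤ h) :
    I.SlackFeasible n i S (T + h) (s + h) p δ := by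
  have hD : T + h - (s + h) = T - s := by ring
  refine ⟨hf.slack_nonneg, by linarith [hf.start_lt], hf.first, hf.last, ?_, hf.monotone, ?_, ?_, ?_⟩
  · rw [hD]
    exact hf.initial
  · intro j hj
    rw [bezierProfile_pos_shift n p hf.start_lt]
    -- A delayed agent is at each time where it formerly was earlier, hence not farther.
    exact (monotone_pos_bezierProfile hn hf.start_lt hf.first hf.monotone (by linarith)).trans
      (hf.not_early j hj)
  · intro j hj u hu
    rw [hS j hj] at hu
    exact absurd hu (WithTop.coe_ne_top).symm
  · rw [hD]
    exact hf.bounds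

/-- The control points of an agent that keeps its minimum speed. -/
noncomputable def uniformCtrl (n : ℕ) (i : ι) (r : ℕ) : ℝ := I.total i * r / n

/-- Linear precision: equally spaced control points give a linear curve, by the mean of the binomial
distribution. -/
theorem bezier_uniformCtrl {n : ℕ} (hn : 1 ≤ n) (i : ι) {D : ℝ} (hD : D ≠ 0) (x : ℝ) :
    bezier n D (I.uniformCtrl n i) x = I.total i * x / D := by
  have hn0 : (n : ℝ) ≠ 0 := by positivity
  have h := congrArg (Polynomial.eval (x / D)) (bernsteinPolynomial.sum_smul ℝ n)
  simp only [Polynomial.eval_finsetSum, nsmul_eq_mul, Polynomial.eval_mul,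
    Polynomial.eval_natCast, Polynomial.eval_X] at h
  rw [bezier_eq_eval n hD, Polynomial.eval_finsetSum]
  simp only [Polynomial.eval_mul, Polynomial.eval_C, uniformCtrl]
  calc _ = I.total i / n * ∑ r ∈ Finset.range (n + 1),
        (r : ℝ) * (bernsteinPolynomial ℝ n r).eval (x / D) := by
        rw [Finset.mul_sum]
        exact Finset.sum_congr rfl fun r _ => by ring
    _ = _ := by rw [h]; field_simp

theorem ctrl_one_uniformCtrl {n : ℕ} (hn : 1 ≤ n) (i : ι) (r : ℕ) :
    ctrl n (I.total i / I.lo i 1) (I.uniformCtrl n i) 1 r = I.lo i 1 := by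
  have hn0 : (n : ℝ) ≠ 0 := by positivity
  have := (I.total_pos i).ne'
  have := (I.minSpeed_pos i).ne'
  rw [ctrl_one]
  simp only [uniformCtrl, Nat.cast_add, Nat.cast_one]
  field_simp
  ring

theorem ctrl_uniformCtrl {n : ℕ} (hn : 1 ≤ n) (i : ι) {k : ℕ} (hk : 1 ≤ k) (r : ℕ) :
    ctrl n (I.total i / I.lo i 1) (I.uniformCtrl n i) k r = I.initial i k := by
  rcases Nat.lt_or_ge 1 k with h | h
  · rw [initial, if_neg h.ne']
    induction k, h using Nat.le_induction generalizing r with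
    | base =>
      rw [ctrl_succ, I.ctrl_one_uniformCtrl hn, I.ctrl_one_uniformCtrl hn, sub_self, mul_zero]
    | succ k hk' ih => rw [ctrl_succ, ih (by omega), ih (by omega), sub_self, mul_zero]
  · obtain rfl : k = 1 := by omega
    rw [I.ctrl_one_uniformCtrl hn, initial, if_pos rfl]

theorem slackFeasible_uniformCtrl {n : ℕ} (hn : 1 ≤ n) {i : ι} {S : ℕ → TimeInterval}
    (hS : ∀ j ≤ I.len i, (S j).ub = ⊤) (T : ℝ) {δ : ℝ} (hδ : 0 ≤ δ)
    (he : ∀ j ≤ I.len i, (bezierProfile n (I.uniformCtrl n i) (T - I.total i / I.lo i 1) T).pos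
      (S j).lb ≤ I.travel i j + δ) :
    I.SlackFeasible n i S T (T - I.total i / I.lo i 1) (I.uniformCtrl n i) δ := by
  have hn0 : (n : ℝ) ≠ 0 := by positivity
  have hD : 0 < I.total i / I.lo i 1 := div_pos (I.total_pos i) (I.minSpeed_pos i)
  have hc : T - (T - I.total i / I.lo i 1) = I.total i / I.lo i 1 := by ring
  refine ⟨hδ, by linarith, by simp [uniformCtrl], ?_, ?_, ?_, he, ?_, ?_⟩
  · rw [uniformCtrl]
    field_simp
  · intro k hk _
    rw [hc, I.ctrl_uniformCtrl hn i hk]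
  · intro r _
    have := (I.total_pos i).le
    unfold uniformCtrl
    gcongr
    exact Nat.le_succ r
  · intro j hj u hu
    rw [hS j hj] at hu
    exact absurd hu (WithTop.coe_ne_top).symm
  · intro k hk hkK r _
    rw [hc, I.ctrl_uniformCtrl hn i hk, initial]
    split_ifs with h
    · subst h
      exact ⟨by linarith, by linarith [I.speed_le i]⟩
    · have := I.higher_bounds i k (by omega) hkK
      exact ⟨by linarith [this.1], by linarith [this.2]⟩

/-- Needed because `sInf ∅ = 0`: without feasible points the infima for two arrival times could not
be compared. The witness is the uniform motion, with a slack exceeding every position at a lower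
bound. -/
theorem exists_slackFeasible {n : ℕ} (hn : 1 ≤ n) {i : ι} {S : ℕ → TimeInterval}
    (hS : ∀ j ≤ I.len i, (S j).ub = ⊤) (T : ℝ) : ∃ δ s p, I.SlackFeasible n i S T s p δ := by
  set f : ℕ → ℝ := fun j =>
    |(bezierProfile n (I.uniformCtrl n i) (T - I.total i / I.lo i 1) T).pos (S j).lb|
  refine ⟨∑ j ∈ Finset.range (I.len i + 1), f j, _, _,
    I.slackFeasible_uniformCtrl hn hS T (Finset.sum_nonneg fun _ _ => abs_nonneg _) ?_⟩
  intro j hj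
  have h1 : f j ≤ ∑ j ∈ Finset.range (I.len i + 1), f j :=
    Finset.single_le_sum (f := f) (fun _ _ => abs_nonneg _)
      (Finset.mem_range.2 (Nat.lt_succ_of_le hj))
  have h2 := le_abs_self
    ((bezierProfile n (I.uniformCtrl n i) (T - I.total i / I.lo i 1) T).pos (S j).lb)
  have h3 := I.travel_nonneg hj
  exact h2.trans (h1.trans (by linarith))

theorem optSlack_nonneg (n : ℕ) (i : ι) (S : ℕ → TimeInterval) (T : ℝ) :
    0 ≤ I.optSlack n i S T :=
  Real.sInf_nonneg fun _ ⟨_, _, hf⟩ => hf.slack_nonneg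

theorem IsZeroSlack.optSlack_eq_zero {I : Intersection V ι K} {n : ℕ} {i : ι}
    {S : ℕ → TimeInterval} {T : ℝ} {P : Profile} (h : I.IsZeroSlack n i S T P) :
    I.optSlack n i S T = 0 := by
  obtain ⟨s, p, -, hf⟩ := h
  exact le_antisymm (csInf_le ⟨0, fun _ ⟨_, _, hf⟩ => hf.slack_nonneg⟩ ⟨s, p, hf⟩)
    (I.optSlack_nonneg n i S T)

theorem gradSlack_nonpos {n : ℕ} (hn : 1 ≤ n) {Δ : ℝ} (hΔ : 0 < Δ) {i : ι} {S : ℕ → TimeInterval}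
    (hS : ∀ j ≤ I.len i, (S j).ub = ⊤) (T : ℝ) : I.gradSlack n Δ i S T ≤ 0 := by
  have : I.optSlack n i S (T + Δ) ≤ I.optSlack n i S T := by
    refine csInf_le_csInf ⟨0, fun _ ⟨_, _, hf⟩ => hf.slack_nonneg⟩
      (I.exists_slackFeasible hn hS T) ?_
    rintro δ ⟨s, p, hf⟩
    exact ⟨_, _, hf.shift hn hS hΔ.le⟩
  exact div_nonpos_of_nonpos_of_nonneg (sub_nonpos.2 this) hΔ.le

theorem upperBound_of_top {i : ι} {S : ℕ → TimeInterval} (h : (S (I.len i)).ub = ⊤) :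
    I.upperBound i S = (Finset.range (I.len i + 1)).sup' Finset.nonempty_range_add_one
      (fun j => (S j).lb - I.travel i j / I.lo i 1) + (I.total i + I.length i) / I.lo i 1 := by
  unfold upperBound
  rw [h]

/-- The length term in `upperBound` leaves a margin of `length / lo` beyond the time needed by the
uniform motion; the tolerance is measured against this margin. -/
theorem lb_add_le_upperBound {i : ι} {S : ℕ → TimeInterval} (h : (S (I.len i)).ub = ⊤) {j : ℕ}
    (hj : j ≤ I.len i) : (S j).lb + (I.total i - I.travel i j) / I.lo i 1 ≤
      I.upperBound i S - I.length i / I.lo i 1 := by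
  have := Finset.le_sup' (fun j => (S j).lb - I.travel i j / I.lo i 1)
    (Finset.mem_range.2 (Nat.lt_succ_of_le hj))
  rw [I.upperBound_of_top h, add_div, sub_div]
  linarith

/-- An agent that enters late enough and keeps its minimum speed is nowhere early. -/
theorem exists_isZeroSlack {n : ℕ} (hn : 1 ≤ n) {i : ι} {S : ℕ → TimeInterval}
    (hS : ∀ j ≤ I.len i, (S j).ub = ⊤) {T : ℝ}
    (hT : I.upperBound i S - I.length i / I.lo i 1 ≤ T) : ∃ P, I.IsZeroSlack n i S T P := by
  have hlo := I.minSpeed_pos i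
  have hD : 0 < I.total i / I.lo i 1 := div_pos (I.total_pos i) hlo
  have hc : T - (T - I.total i / I.lo i 1) = I.total i / I.lo i 1 := by ring
  have hsT : T - I.total i / I.lo i 1 < T := by linarith
  refine ⟨_, _, _, rfl, I.slackFeasible_uniformCtrl hn hS T le_rfl fun j hj => ?_⟩
  have h1 := I.lb_add_le_upperBound (hS _ le_rfl) hj
  have h2 : (S j).lb - (T - I.total i / I.lo i 1) ≤ I.travel i j / I.lo i 1 := by
    rw [sub_div] at h1
    linarith
  have h3 : I.lo i 1 * ((S j).lb - (T - I.total i / I.lo i 1)) ≤ I.travel i j := by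
    rw [le_div_iff₀ hlo] at h2
    linarith
  rw [bezierProfile_pos n _ hsT, hc, I.bezier_uniformCtrl hn i hD.ne',
    I.ctrl_one_uniformCtrl hn, add_zero]
  have ht0 := (I.total_pos i).ne'
  split_ifs with h4 h5
  · exact I.travel_nonneg hj
  · refine le_trans (le_of_eq ?_) h3
    field_simp
  · refine le_trans (le_of_eq ?_) h3
    have : (n : ℝ) ≠ 0 := by positivity
    rw [uniformCtrl]
    field_simp
    ring

end Intersection

/-! ### Invariants and termination of the bisection. -/

section Level3

variable {V ι : Type*} {K : ℕ} {I : Intersection V ι K} {n : ℕ} {ε Δ : ℝ} {i : ι}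
  {S : ℕ → TimeInterval}

/-- The best profile so far or the result of Level 3 has slack zero. -/
def BCPState.Sound (I : Intersection V ι K) (n : ℕ) (i : ι) (S : ℕ → TimeInterval) :
    BCPState → Prop
  | start => True
  | search _ _ best => ∀ P, best = some P → ∃ T, I.IsZeroSlack n i S T P
  | done r => ∀ P, r = some P → ∃ T, I.IsZeroSlack n i S T P

/-- As long as Level 3 has found no profile, its upper bound is the initial one. -/
def BCPState.Promising (I : Intersection V ι K) (ε : ℝ) (i : ι) (S : ℕ → TimeInterval) :
    BCPState → Prop
  | start => True
  | search Tlb Tub best => best = none → Tub = I.upperBound i S ∧ ε < Tub - Tlb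
  | done r => r ≠ none

theorem BCPStep.sound {b b' : BCPState} (h : BCPStep I n ε Δ i S b b') (hb : b.Sound I n i S) :
    b'.Sound I n i S := by
  cases h with
  | init => exact fun P hP => absurd hP (by simp)
  | noSolution => exact fun P hP => absurd hP (by simp)
  | feasible _ _ _ P _ hP =>
    rintro Q hQ
    cases hQ
    exact ⟨_, hP⟩
  | left => exact hb
  | right => exact hb
  | halt => exact hb

/-- Slack zero is attained at the upper bound and the gradient is never positive, so neither
`noSolution` nor `left` can occur. -/
theorem BCPStep.promising (hn : 1 ≤ n) (hε : 0 < ε) (hε' : ε < I.length i / I.lo i 1) (hΔ : 0 < Δ)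
    (hS : ∀ j ≤ I.len i, (S j).ub = ⊤) {b b' : BCPState} (h : BCPStep I n ε Δ i S b b')
    (hb : b.Promising I ε i S) : b'.Promising I ε i S := by
  cases h with
  | init =>
    refine fun _ => ⟨rfl, ?_⟩
    have := I.lb_add_le_upperBound (hS _ le_rfl) le_rfl
    rw [← Intersection.total, sub_self, zero_div] at this
    linarith
  | noSolution hno =>
    refine absurd ⟨I.gradSlack_nonpos hn hΔ hS _, ?_⟩ hno
    have hlen : 0 < I.length i / I.lo i 1 := hε.trans hε'
    obtain ⟨P, hP⟩ := I.exists_isZeroSlack hn hS (T := I.upperBound i S) (by linarith)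
    rw [Intersection.gradSlack, hP.optSlack_eq_zero, sub_zero]
    exact div_nonneg (I.optSlack_nonneg _ _ _ _) hΔ.le
  | feasible => exact fun h => absurd h (by simp)
  | left _ _ _ _ _ hgrad => exact absurd hgrad (not_lt.2 (I.gradSlack_nonpos hn hΔ hS _))
  | right Tlb Tub best _ hno =>
    intro hbest
    refine ⟨(hb hbest).1, ?_⟩
    -- If at most `ε` remained above the midpoint, the midpoint would lie in the range where the
    -- uniform motion is feasible.
    by_contra hle
    refine hno (I.exists_isZeroSlack hn hS ?_)
    rw [← (hb hbest).1]
    linarith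
  | halt _ _ _ hle => exact fun h => absurd (hb h).2 (not_lt.2 hle)

theorem BCPState.exists_step (b : BCPState) (hb : ∀ r, b ≠ .done r) :
    ∃ b', BCPStep I n ε Δ i S b b' := by
  rcases b with _ | ⟨Tlb, Tub, best⟩ | r
  · by_cases h : I.gradSlack n Δ i S (S (I.len i)).lb ≤ 0 ∧
      0 ≤ I.gradSlack n Δ i S (I.upperBound i S)
    exacts [⟨_, .init h.1 h.2⟩, ⟨_, .noSolution h⟩]
  · rcases lt_or_ge ε (Tub - Tlb) with h | h
    · by_cases hP : ∃ P, I.IsZeroSlack n i S ((Tlb + Tub) / 2) P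
      · obtain ⟨P, hP⟩ := hP
        exact ⟨_, .feasible _ _ _ P h hP⟩
      · rcases lt_or_ge 0 (I.gradSlack n Δ i S ((Tlb + Tub) / 2)) with hg | hg
        exacts [⟨_, .left _ _ _ h hP hg⟩, ⟨_, .right _ _ _ h hP hg⟩]
    · exact ⟨_, .halt _ _ _ h⟩
  · exact absurd rfl (hb r)

/-- Level 3 stops. -/
theorem BCPState.acc (hε : 0 < ε) (b : BCPState) : Acc (flip (BCPStep I n ε Δ i S)) b := by
  have hdone : ∀ r, Acc (flip (BCPStep I n ε Δ i S)) (.done r) :=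
    fun r => ⟨_, fun b' h => nomatch h⟩
  -- The exponent `m` bounds the number of halvings left.
  have hsearch : ∀ (m : ℕ) (Tlb Tub : ℝ) (best : Option Profile), Tub - Tlb ≤ ε * 2 ^ m →
      Acc (flip (BCPStep I n ε Δ i S)) (.search Tlb Tub best) := by
    intro m
    induction m with
    | zero =>
      intro Tlb Tub best hle
      rw [pow_zero, mul_one] at hle
      refine ⟨_, fun b' h => ?_⟩
      cases h with
      | halt => exact hdone _
      | feasible _ _ _ _ hlt => exact absurd hlt (not_lt.2 hle)
      | left _ _ _ hlt => exact absurd hlt (not_lt.2 hle)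
      | right _ _ _ hlt => exact absurd hlt (not_lt.2 hle)
    | succ m ih =>
      intro Tlb Tub best hle
      rw [pow_succ] at hle
      refine ⟨_, fun b' h => ?_⟩
      cases h with
      | halt => exact hdone _
      | feasible => exact ih _ _ _ (by linarith)
      | left => exact ih _ _ _ (by linarith)
      | right => exact ih _ _ _ (by linarith)
  have hsearch' : ∀ Tlb Tub best, Acc (flip (BCPStep I n ε Δ i S)) (.search Tlb Tub best) := by
    intro Tlb Tub best
    obtain ⟨m, hm⟩ := pow_unbounded_of_one_lt ((Tub - Tlb) / ε) (one_lt_two (α := ℝ))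
    rw [div_lt_iff₀ hε] at hm
    exact hsearch m _ _ _ (by linarith)
  rcases b with _ | ⟨Tlb, Tub, best⟩ | r
  · refine ⟨_, fun b' h => ?_⟩
    cases h with
    | init => exact hsearch' _ _ _
    | noSolution => exact hdone _
  · exact hsearch' _ _ _
  · exact hdone r

end Level3

/-! ### Level 2 -/

section Level2

/-- The interval `J` lies within the interval `J'`. -/
def TimeInterval.Within (J J' : TimeInterval) : Prop := J'.lb ≤ J.lb ∧ J.ub ≤ J'.ub

/-- The interval `J` is disjoint from `[b.1, b.2)`, being before it or after it. -/
def TimeInterval.Avoids (J : TimeInterval) (b : ℝ × ℝ) : Prop :=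
  J.ub ≤ (b.1 : WithTop ℝ) ∨ b.2 ≤ J.lb

theorem TimeInterval.Within.trans {J J' J'' : TimeInterval} (h : J.Within J')
    (h' : J'.Within J'') : J.Within J'' := ⟨h'.1.trans h.1, h.2.trans h'.2⟩

theorem TimeInterval.Within.avoids {J J' : TimeInterval} (h : J.Within J') {b : ℝ × ℝ}
    (h' : J'.Avoids b) : J.Avoids b := h'.imp h.2.trans fun h'' => h''.trans h.1

theorem TimeInterval.mem_remove {J J' : TimeInterval} {b : ℝ × ℝ} (h : J' ∈ J.remove b) :
    J'.Within J ∧ (J'.lb : WithTop ℝ) < J'.ub ∧ J'.Avoids b := by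
  simp only [TimeInterval.remove, List.mem_filter, List.mem_cons, List.not_mem_nil, or_false,
    decide_eq_true_eq] at h
  obtain ⟨rfl | rfl, hlt⟩ := h
  · exact ⟨⟨le_rfl, min_le_left _ _⟩, hlt, Or.inl (min_le_right _ _)⟩
  · exact ⟨⟨le_max_left _ _, le_rfl⟩, hlt, Or.inr (le_max_right _ _)⟩

theorem mem_foldl_remove {bs : List (ℝ × ℝ)} {Js : List TimeInterval} {J : TimeInterval}
    (hJs : ∀ J' ∈ Js, (J'.lb : WithTop ℝ) < J'.ub)
    (hJ : J ∈ bs.foldl (fun Js b => Js.flatMap (fun J => J.remove b)) Js) :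
    (J.lb : WithTop ℝ) < J.ub ∧ (∃ J' ∈ Js, J.Within J') ∧ ∀ b ∈ bs, J.Avoids b := by
  induction bs generalizing Js with
  | nil => exact ⟨hJs J hJ, ⟨J, hJ, le_rfl, le_rfl⟩, by simp⟩
  | cons b bs ih =>
    obtain ⟨hlt, ⟨J', hJ', hw⟩, hav⟩ := ih (fun J' hJ' => by
      obtain ⟨J₀, -, h⟩ := List.mem_flatMap.1 hJ'
      exact (TimeInterval.mem_remove h).2.1) hJ
    obtain ⟨J₀, hJ₀, h⟩ := List.mem_flatMap.1 hJ'
    have h := TimeInterval.mem_remove h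
    exact ⟨hlt, ⟨J₀, hJ₀, hw.trans h.1⟩, List.forall_mem_cons.2 ⟨hw.avoids h.2.2, hav⟩⟩

/-- A block has a finite right end, so the part of an unbounded interval after it is nonempty and
unbounded. -/
theorem exists_top_mem_foldl_remove (bs : List (ℝ × ℝ)) {Js : List TimeInterval}
    (hJs : ∃ J ∈ Js, J.ub = ⊤) :
    ∃ J ∈ bs.foldl (fun Js b => Js.flatMap (fun J => J.remove b)) Js, J.ub = ⊤ := by
  induction bs generalizing Js with
  | nil => exact hJs
  | cons b bs ih =>
    obtain ⟨J, hJ, htop⟩ := hJs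
    refine ih ⟨⟨max J.lb b.2, J.ub⟩, List.mem_flatMap.2 ⟨J, hJ, ?_⟩, htop⟩
    simp only [TimeInterval.remove, List.mem_filter, List.mem_cons, or_true, true_or, htop,
      true_and, decide_eq_true_eq]
    exact WithTop.coe_lt_top _

namespace Intersection

variable {V ι : Type*} {K : ℕ} (I : Intersection V ι K)

/-- Agent `i` with the trajectory `P` keeps clear of agent `j` with the trajectory `Q`: they do not
collide, and `i` does not overtake `j`. -/
def Clear (j : ι) (Q : Profile) (i : ι) (P : Profile) : Prop :=
  ∀ r ≤ I.len j, ∀ q ≤ I.len i, I.path j r = I.path i q →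
    (I.leave i P q ≤ I.reach j Q r ∨ I.leave j Q r ≤ I.reach i P q) ∧
    (I.Ahead j i → I.leave j Q r ≤ I.reach i P q)

/-- A feasible trajectory of agent `i` that keeps clear of the agents whose trajectories are given
by `H`. -/
def Valid (H : ι → Option Profile) (i : ι) (P : Profile) : Prop :=
  I.IsKinodynamic i P ∧ ∀ j Q, H j = some Q → I.Clear j Q i P

/-- The intervals of a node lie within safe intervals. -/
def Fits [Fintype ι] (H : ι → Option Profile) (i : ι) (N : SIPPNode) : Prop :=
  N.depth ≤ I.len i ∧ ∀ q ≤ N.depth, ∃ J ∈ I.safeIntervals H i q, (N.ivl q).Within J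

variable {I} [Fintype ι] {H : ι → Option Profile} {i : ι}

theorem mem_safeIntervals {q : ℕ} {J : TimeInterval} (hJ : J ∈ I.safeIntervals H i q) :
    (J.lb : WithTop ℝ) < J.ub ∧ I.earliest i ≤ J.lb ∧ ∀ b ∈ I.blocks H i q, J.Avoids b := by
  obtain ⟨h1, ⟨J', hJ', hw⟩, h2⟩ := mem_foldl_remove
    (by simp only [List.mem_singleton, forall_eq]; exact WithTop.coe_lt_top _) hJ
  rw [List.mem_singleton] at hJ'
  subst hJ'
  exact ⟨h1, hw.1, h2⟩

theorem exists_top_mem_safeIntervals (H : ι → Option Profile) (i : ι) (q : ℕ) :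
    ∃ J ∈ I.safeIntervals H i q, J.ub = ⊤ :=
  exists_top_mem_foldl_remove _ ⟨_, List.mem_singleton_self _, rfl⟩

open Classical in
theorem mem_blocks {j : ι} {Q : Profile} (hQ : H j = some Q) {q r : ℕ} (hr : r ≤ I.len j)
    (h : I.path j r = I.path i q) :
    (if I.Ahead j i then min (I.earliest i) (I.reach j Q r) else I.reach j Q r, I.leave j Q r) ∈
      I.blocks H i q := by
  refine List.mem_flatMap.2 ⟨j, Finset.mem_toList.2 (Finset.mem_univ _), ?_⟩
  rw [hQ]
  refine List.mem_map.2 ⟨r, List.mem_filter.2 ⟨List.mem_range.2 (Nat.lt_succ_of_le hr), ?_⟩, rfl⟩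
  simpa using h

theorem Fits.earliest_le {N : SIPPNode} (hN : I.Fits H i N) : I.earliest i ≤ (N.ivl 0).lb := by
  obtain ⟨J, hJ, hw⟩ := hN.2 0 (Nat.zero_le _)
  exact (mem_safeIntervals hJ).2.1.trans hw.1

theorem Fits.valid {N : SIPPNode} (hN : I.Fits H i N) (hdepth : N.depth = I.len i) {n : ℕ}
    (hn : 1 ≤ n) {T : ℝ} {P : Profile} (hP : I.IsZeroSlack n i N.ivl T P) : I.Valid H i P := by
  refine ⟨hP.isKinodynamic hn hN.earliest_le, fun j Q hQ r hr q hq hpath => ?_⟩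
  obtain ⟨J, hJ, hw⟩ := hN.2 q (hq.trans_eq hdepth.symm)
  obtain ⟨hne, he, hav⟩ := mem_safeIntervals hJ
  have hlb := hP.le_reach hn hN.earliest_le hq
  have hav := hav _ (mem_blocks hQ hr hpath)
  by_cases hah : I.Ahead j i
  · rw [if_pos hah] at hav
    have hafter : I.leave j Q r ≤ I.reach i P q := by
      -- A block of an agent ahead begins no later than `earliest i`, so a nonempty safe interval
      -- cannot precede it.
      refine hav.elim (fun h => absurd hne (not_lt.2 ?_)) fun h => (h.trans hw.1).trans hlb
      exact h.trans (WithTop.coe_le_coe.2 ((min_le_left _ _).trans he))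
    exact ⟨Or.inr hafter, fun _ => hafter⟩
  · rw [if_neg hah] at hav
    refine ⟨(hw.avoids hav).imp (fun h => ?_) fun h => h.trans hlb, fun h => absurd h hah⟩
    -- An interval preceding a block has a finite end, so `not_late` applies to it.
    obtain ⟨u, hu⟩ := WithTop.ne_top_iff_exists.1 (ne_top_of_le_ne_top WithTop.coe_ne_top h)
    rw [← hu] at h
    exact (hP.leave_le hq hu.symm).trans (WithTop.coe_le_coe.1 h)

theorem of_mem_expand {N N' : SIPPNode} (h : N' ∈ I.expand H i N) :
    N'.depth = N.depth + 1 ∧ (∀ q ≤ N.depth, N'.ivl q = N.ivl q) ∧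
      ∃ J ∈ I.safeIntervals H i (N.depth + 1), (N'.ivl (N.depth + 1)).Within J := by
  rw [expand, Multiset.mem_coe, List.mem_filterMap] at h
  obtain ⟨J, hJ, h⟩ := h
  simp only [extend, Option.ite_none_right_eq_some, Option.some.injEq] at h
  obtain ⟨-, rfl⟩ := h
  refine ⟨rfl, fun q hq => Function.update_of_ne (by omega) _ _, J, hJ, ?_⟩
  simp only [Function.update_self]
  exact ⟨le_max_left _ _, min_le_left _ _⟩

theorem Fits.of_mem_expand {N N' : SIPPNode} (hN : I.Fits H i N) (hlt : N.depth < I.len i)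
    (h : N' ∈ I.expand H i N) : I.Fits H i N' := by
  obtain ⟨h1, h2, h3⟩ := Intersection.of_mem_expand h
  refine ⟨by omega, fun q hq => ?_⟩
  rcases Nat.lt_or_ge N.depth q with hq' | hq'
  · obtain rfl : q = N.depth + 1 := by omega
    exact h3
  · rw [h2 q hq']
    exact hN.2 q hq'

end Intersection

/-! ### Invariant, progress and termination of Level 2. -/

/-- All intervals of a node are unbounded. -/
def SIPPNode.Unbounded (N : SIPPNode) : Prop := ∀ q ≤ N.depth, (N.ivl q).ub = ⊤

variable {V ι : Type*} {K : ℕ} {I : Intersection V ι K} [Fintype ι] {n : ℕ} {ε Δ : ℝ} {i : ι}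
  {H : ι → Option Profile}

theorem SIPPNode.Unbounded.exists_mem_expand {N : SIPPNode} (hN : N.Unbounded) :
    ∃ N' ∈ I.expand H i N, N'.Unbounded := by
  obtain ⟨J, hJ, htop⟩ := Intersection.exists_top_mem_safeIntervals (I := I) H i (N.depth + 1)
  have hub := hN _ le_rfl
  have hext : I.extend i N J = some _ := if_pos (by
    rw [htop, hub, WithTop.top_add, min_self]
    exact WithTop.coe_lt_top _)
  refine ⟨_, Multiset.mem_coe.2 (List.mem_filterMap.2 ⟨J, hJ, hext⟩), fun q hq => ?_⟩
  rcases Nat.lt_or_ge N.depth q with hq' | hq'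
  · obtain rfl : q = N.depth + 1 := le_antisymm hq hq'
    simp only [Function.update_self]
    rw [htop, hub, WithTop.top_add, min_self]
  · simp only
    rw [Function.update_of_ne (by omega)]
    exact hN q hq'

/-- The invariant of Level 2: nodes lie within safe intervals, profiles are valid, and as long as
no profile has been found, an unbounded node is open or will be solved by Level 3. -/
def SIPPState.Good (I : Intersection V ι K) (n : ℕ) (ε : ℝ) (H : ι → Option Profile) (i : ι) :
    SIPPState → Prop
  | search opn best => (∀ N ∈ opn, I.Fits H i N) ∧ (∀ P, best = some P → I.Valid H i P) ∧
      (best = none → ∃ N ∈ opn, N.Unbounded)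
  | level3 opn best N b => (∀ N ∈ opn, I.Fits H i N) ∧ (∀ P, best = some P → I.Valid H i P) ∧
      (best = none → (∃ N ∈ opn, N.Unbounded) ∨ N.Unbounded ∧ b.Promising I ε i N.ivl) ∧
      I.Fits H i N ∧ N.depth = I.len i ∧ b.Sound I n i N.ivl
  | done r => r ≠ none ∧ ∀ P, r = some P → I.Valid H i P

theorem SIPPState.good_init : (SIPPState.init I H i).Good I n ε H i := by
  refine ⟨fun N hN => ?_, fun P hP => absurd hP (by simp), fun _ => ?_⟩
  · obtain ⟨J, hJ, rfl⟩ := List.mem_map.1 (Multiset.mem_coe.1 hN)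
    refine ⟨Nat.zero_le _, fun q hq => ?_⟩
    obtain rfl : q = 0 := Nat.le_zero.1 hq
    exact ⟨J, hJ, le_rfl, le_rfl⟩
  · obtain ⟨J, hJ, htop⟩ := Intersection.exists_top_mem_safeIntervals (I := I) H i 0
    exact ⟨_, Multiset.mem_coe.2 (List.mem_map.2 ⟨J, hJ, rfl⟩), fun _ _ => htop⟩

theorem keepBest_eq_some {best r : Option Profile} {P : Profile} (h : keepBest best r = some P) :
    best = some P ∨ r = some P := by
  rcases r with _ | Q
  · exact Or.inl h
  · simp only [keepBest] at h
    split_ifs at h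
    exacts [Or.inr h, Or.inl h]

theorem keepBest_eq_none {best r : Option Profile} (h : keepBest best r = none) :
    best = none ∧ r = none := by
  rcases r with _ | Q
  · exact ⟨h, rfl⟩
  · simp only [keepBest] at h
    split_ifs at h with himp
    exact absurd (by rw [h]; trivial) himp

/-- An unbounded node that is expanded is replaced by an unbounded child; one at the goal makes
Level 3 succeed. Without a profile every open node improves, so the search cannot finish. -/
theorem SIPPStep.good (hn : 1 ≤ n) (hε : 0 < ε) (hε' : ε < I.length i / I.lo i 1) (hΔ : 0 < Δ)
    {s s' : SIPPState} (h : SIPPStep I n ε Δ H i s s') (hs : s.Good I n ε H i) :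
    s'.Good I n ε H i := by
  cases h with
  | finish opn best hno =>
    refine ⟨fun hb => ?_, hs.2.1⟩
    obtain ⟨N, hN, -⟩ := hs.2.2 hb
    exact hno N hN (by rw [hb]; trivial)
  | expand opn best N _ _ hlt =>
    obtain ⟨h1, h2, h3⟩ := hs
    rw [Multiset.forall_mem_cons] at h1
    refine ⟨fun N' hN' => (Multiset.mem_add.1 hN').elim (h1.2 N') (h1.1.of_mem_expand hlt), h2,
      fun hb => ?_⟩
    obtain ⟨N', hN', hub⟩ := h3 hb
    rcases Multiset.mem_cons.1 hN' with rfl | hN'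
    · obtain ⟨N'', hN'', hub⟩ := hub.exists_mem_expand (I := I) (H := H) (i := i)
      exact ⟨N'', Multiset.mem_add.2 (Or.inr hN''), hub⟩
    · exact ⟨N', Multiset.mem_add.2 (Or.inl hN'), hub⟩
  | call opn best N _ _ hlen =>
    obtain ⟨h1, h2, h3⟩ := hs
    rw [Multiset.forall_mem_cons] at h1
    refine ⟨h1.2, h2, fun hb => ?_, h1.1, hlen, trivial⟩
    obtain ⟨N', hN', hub⟩ := h3 hb
    rcases Multiset.mem_cons.1 hN' with rfl | hN'
    exacts [Or.inr ⟨hub, trivial⟩, Or.inl ⟨N', hN', hub⟩]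
  | inner opn best N b b' hb =>
    obtain ⟨h1, h2, h3, h4, h5, h6⟩ := hs
    refine ⟨h1, h2, fun hbest => (h3 hbest).imp_right fun h => ⟨h.1, ?_⟩, h4, h5, hb.sound h6⟩
    exact hb.promising hn hε hε' hΔ (fun j hj => h.1 j (hj.trans_eq h5.symm)) h.2
  | ret opn best N r =>
    obtain ⟨h1, h2, h3, h4, h5, h6⟩ := hs
    refine ⟨h1, fun P hP => ?_, fun hnone => ?_⟩
    · rcases keepBest_eq_some hP with hP | hP
      · exact h2 P hP
      · obtain ⟨T, hT⟩ := h6 P hP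
        exact h4.valid h5 hn hT
    · obtain ⟨hb, hr⟩ := keepBest_eq_none hnone
      exact (h3 hb).resolve_right fun h => h.2 hr

theorem SIPPState.exists_step {s : SIPPState} (hs : s.Good I n ε H i) (hdone : ∀ r, s ≠ .done r) :
    ∃ s', SIPPStep I n ε Δ H i s s' := by
  rcases s with ⟨opn, best⟩ | ⟨opn, best, N, b⟩ | r
  · by_cases hall : ∀ N ∈ opn, ¬ Improves best (I.fValue i N)
    · exact ⟨_, .finish _ _ hall⟩
    push Not at hall
    obtain ⟨N₁, hN₁, himp⟩ := hall
    obtain ⟨N, hN, hmin⟩ := Set.exists_min_image {N | N ∈ opn} (I.fValue i)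
      (Multiset.finite_toSet opn) ⟨N₁, hN₁⟩
    have himpN : Improves best (I.fValue i N) := by
      rcases best with _ | P
      exacts [trivial, (hmin N₁ hN₁).trans_lt himp]
    obtain ⟨opn, rfl⟩ := Multiset.exists_cons_of_mem hN
    have hmin' : ∀ N' ∈ opn, I.fValue i N ≤ I.fValue i N' :=
      fun N' hN' => hmin N' (Multiset.mem_cons_of_mem hN')
    rcases (hs.1 N hN).1.lt_or_eq with hlt | heq
    exacts [⟨_, .expand _ _ _ hmin' himpN hlt⟩, ⟨_, .call _ _ _ hmin' himpN heq⟩]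
  · by_cases hb : ∃ r, b = .done r
    · obtain ⟨r, rfl⟩ := hb
      exact ⟨_, .ret _ _ _ _⟩
    · push Not at hb
      obtain ⟨b', hb'⟩ := b.exists_step (I := I) (n := n) (ε := ε) (Δ := Δ) (i := i) (S := N.ivl) hb
      exact ⟨_, .inner _ _ _ _ _ hb'⟩
  · exact absurd rfl (hdone r)

/-- Level 2 stops. -/
theorem SIPPState.acc (hε : 0 < ε) (s : SIPPState) : Acc (flip (SIPPStep I n ε Δ H i)) s := by
  have hdone : ∀ r, Acc (flip (SIPPStep I n ε Δ H i)) (.done r) := fun r => ⟨_, fun s h => nomatch h⟩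
  have hlevel3 : ∀ opn, (∀ best, Acc (flip (SIPPStep I n ε Δ H i)) (.search opn best)) →
      ∀ best N b, Acc (flip (SIPPStep I n ε Δ H i)) (.level3 opn best N b) := by
    intro opn hopn best N b
    induction BCPState.acc (I := I) (n := n) (Δ := Δ) (i := i) (S := N.ivl) hε b with
    | intro b _ ih =>
      refine ⟨_, fun s h => ?_⟩
      cases h with
      | inner _ _ _ _ b' hb => exact ih b' hb
      | ret => exact hopn _
  have hsearch : ∀ opn best, Acc (flip (SIPPStep I n ε Δ H i)) (.search opn best) := by
    intro opn
    -- Expansion replaces a node by finitely many nodes of smaller remaining depth, a call just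
    -- removes one. `best` stays arbitrary, as Level 3 may change it.
    induction opn using (InvImage.wf (fun N : SIPPNode => I.len i - N.depth)
      Nat.lt_wfRel.wf).cutExpand.induction with
    | _ opn ih =>
      refine fun best => ⟨_, fun s h => ?_⟩
      cases h with
      | finish => exact hdone _
      | expand opn _ N _ _ hlt =>
        refine ih _ ⟨I.expand H i N, N, fun N' hN' => ?_, ?_⟩ _
        · have := (Intersection.of_mem_expand hN').1
          change I.len i - N'.depth < I.len i - N.depth
          omega
        · rw [← Multiset.singleton_add]
          abel
      | call opn _ N => exact hlevel3 opn (ih _ ⟨0, N, by simp, by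
          rw [← Multiset.singleton_add]; abel⟩) _ _ _
  rcases s with ⟨opn, best⟩ | ⟨opn, best, N, b⟩ | r
  exacts [hsearch _ _, hlevel3 _ (hsearch _) _ _ _, hdone r]

end Level2

/-! ### Level 1 -/

section Level1

/-- A chain that uses the new edge is cut at its first and its last use. -/
theorem transGen_addOrder {ι : Type*} {o : ι → ι → Prop} {i j a b : ι}
    (h : Relation.TransGen (addOrder o i j) a b) :
    Relation.TransGen o a b ∨ Relation.ReflTransGen o a i ∧ Relation.ReflTransGen o j b := by
  induction h with
  | single h =>
    rcases h with h | ⟨rfl, rfl⟩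
    exacts [Or.inl (.single h), Or.inr ⟨.refl, .refl⟩]
  | tail _ h ih =>
    rcases h with h | ⟨rfl, rfl⟩
    · exact ih.imp (fun h' => h'.tail h) fun h' => ⟨h'.1, h'.2.tail h⟩
    · exact Or.inr ⟨ih.elim (fun h' => h'.to_reflTransGen) And.left, .refl⟩

variable {V ι : Type*} {K : ℕ} {I : Intersection V ι K}

/-- Acyclic orderings that contain those of the agents from the same entry lane. -/
structure Admissible (I : Intersection V ι K) (o : ι → ι → Prop) : Prop where
  ahead : ∀ i j, I.Ahead i j → o i j
  acyclic : ∀ i, ¬ Relation.TransGen o i i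

theorem admissible_ahead (I : Intersection V ι K) : Admissible I I.Ahead := by
  refine ⟨fun _ _ h => h, fun i h => ?_⟩
  have : ∀ j, Relation.TransGen I.Ahead i j → I.earliest i < I.earliest j := by
    intro j h
    induction h with
    | single h => exact h.2
    | tail _ h ih => exact ih.trans h.2
  exact lt_irrefl _ (this i h)

theorem Admissible.addOrder {o : ι → ι → Prop} (ho : Admissible I o) {i j : ι} (hij : i ≠ j)
    (h : ¬ Relation.TransGen o j i) : Admissible I (addOrder o i j) := by
  refine ⟨fun a b hab => Or.inl (ho.ahead a b hab), fun a ha => ?_⟩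
  rcases transGen_addOrder ha with ha | ⟨hai, hja⟩
  · exact ho.acyclic a ha
  · rcases Relation.reflTransGen_iff_eq_or_transGen.1 (hja.trans hai) with heq | hji
    exacts [hij heq, h hji]

/-- The trajectories found so far are feasible, and clear of those of higher priority. -/
def PlanGood (I : Intersection V ι K) (o : ι → ι → Prop) (pl : ι → Option Profile) : Prop :=
  ∀ i P, pl i = some P → I.IsKinodynamic i P ∧
    ∀ j, Relation.TransGen o j i → ∃ Q, pl j = some Q ∧ I.Clear j Q i P

/-- The invariant of the nodes of the priority tree. -/
structure PTNode.Good (I : Intersection V ι K) (N : PTNode ι) : Prop where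
  admissible : Admissible I N.order
  kinodynamic : ∀ i, I.IsKinodynamic i (N.traj i)
  clear : ∀ j i, Relation.TransGen N.order j i → I.Clear j (N.traj j) i (N.traj i)

theorem Intersection.Collide.symm {traj : ι → Profile} {i j : ι} (h : I.Collide traj i j) :
    I.Collide traj j i := by
  obtain ⟨hij, q, hq, r, hr, hpath, hd⟩ := h
  exact ⟨hij.symm, r, hr, q, hq, hpath.symm, fun h => hd h.symm⟩

/-- The lower agent of an ordered pair keeps clear of the higher one, so only incomparable agents
can collide. -/
theorem PTNode.Good.not_transGen {N : PTNode ι} (hN : N.Good I) {i j : ι}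
    (h : I.Collide N.traj i j) : ¬ Relation.TransGen N.order i j := by
  intro ho
  obtain ⟨-, q, hq, r, hr, hpath, hd⟩ := h
  refine hd (Set.Ico_disjoint_Ico.2 ?_)
  exact (hN.clear i j ho q hq r hr hpath).1.elim
    (fun h => (min_le_right _ _).trans (h.trans (le_max_left _ _)))
    fun h => (min_le_left _ _).trans (h.trans (le_max_right _ _))

theorem PTNode.Good.isSolution {N : PTNode ι} (hN : N.Good I)
    (h : ∀ i j, ¬ I.Collide N.traj i j) : I.IsSolution N.traj := by
  refine ⟨hN.kinodynamic, h, fun i j ⟨hah, q, hq, r, hr, hpath, hle⟩ => ?_⟩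
  have h1 := (hN.clear i j (.single (hN.admissible.ahead i j hah)) q hq r hr hpath).2 hah
  have h2 := (hN.kinodynamic i).reach_lt_leave q
  linarith

/-- The number of pairs of agents that are not ordered. -/
noncomputable def unordered (o : ι → ι → Prop) : ℕ :=
  {a : ι × ι | ¬ Relation.TransGen o a.1 a.2}.ncard

theorem unordered_addOrder_lt [Finite ι] {o : ι → ι → Prop} {i j : ι}
    (h : ¬ Relation.TransGen o i j) : unordered (addOrder o i j) < unordered o := by
  refine Set.ncard_lt_ncard ⟨fun a ha hoa => ha
    (Relation.TransGen.mono (fun _ _ => Or.inl) _ _ hoa), fun hsub => ?_⟩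
    (Set.toFinite _)
  exact hsub (a := (i, j)) h (.single (Or.inr ⟨rfl, rfl⟩))

theorem PlanGood.update [DecidableEq ι] {o : ι → ι → Prop} {pl : ι → Option Profile}
    (hpl : PlanGood I o pl) (ho : Admissible I o) {i : ι} (hi : pl i = none)
    (hj : ∀ j, Relation.TransGen o j i → pl j ≠ none) {P : Profile}
    (hP : I.Valid (higher o pl i) i P) : PlanGood I o (Function.update pl i (some P)) := by
  intro a Q hQ
  rcases eq_or_ne a i with rfl | hai
  · rw [Function.update_self, Option.some.injEq] at hQ
    subst hQ
    refine ⟨hP.1, fun j hja => ?_⟩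
    obtain ⟨R, hR⟩ := Option.ne_none_iff_exists'.1 (hj j hja)
    have hne : j ≠ a := by
      rintro rfl
      exact ho.acyclic _ hja
    exact ⟨R, by rw [Function.update_of_ne hne, hR], hP.2 j R (by rw [higher, if_pos hja, hR])⟩
  · rw [Function.update_of_ne hai] at hQ
    refine ⟨(hpl a Q hQ).1, fun j hja => ?_⟩
    obtain ⟨R, hR, hc⟩ := (hpl a Q hQ).2 j hja
    -- The agents above a planned agent are themselves planned, so `i` is not among them.
    have hne : j ≠ i := by
      rintro rfl
      rw [hi] at hR
      cases hR
    exact ⟨R, by rw [Function.update_of_ne hne, hR], hc⟩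

variable [Fintype ι] {n : ℕ} {ε Δ : ℝ}

/-- The invariant of PSB. -/
def State.Good (I : Intersection V ι K) (n : ℕ) (ε : ℝ) : State ι → Prop
  | search stack => stack ≠ [] ∧ ∀ N ∈ stack, N.Good I
  | siblings stack ready todo => (∀ N ∈ stack, N.Good I) ∧ (∀ N ∈ ready, N.Good I) ∧
      (∀ o ∈ todo, Admissible I o) ∧ (ready = [] → todo ≠ [])
  | plan stack ready todo o pl => (∀ N ∈ stack, N.Good I) ∧ (∀ N ∈ ready, N.Good I) ∧
      (∀ o ∈ todo, Admissible I o) ∧ Admissible I o ∧ PlanGood I o pl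
  | level2 stack ready todo o pl i s => (∀ N ∈ stack, N.Good I) ∧ (∀ N ∈ ready, N.Good I) ∧
      (∀ o ∈ todo, Admissible I o) ∧ Admissible I o ∧ PlanGood I o pl ∧ pl i = none ∧
      (∀ j, Relation.TransGen o j i → pl j ≠ none) ∧ s.Good I n ε (higher o pl i) i
  | solved traj => I.IsSolution traj
  | failed => False

theorem State.good_init : (State.init I).Good I n ε :=
  ⟨by simp, by simp, by simpa using admissible_ahead I, by simp⟩

-- `cyclic` and `discard` contradict the invariant. Hence every ordering still to be treated yields
-- a node, and the stack never runs empty.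
open Classical in
theorem Step.good (hn : 1 ≤ n) (hε : 0 < ε) (hε' : ∀ i, ε < I.length i / I.lo i 1) (hΔ : 0 < Δ)
    {σ σ' : State ι} (h : Step I n ε Δ σ σ') (hσ : σ.Good I n ε) : σ'.Good I n ε := by
  cases h with
  | fail => exact hσ.1 rfl
  | success N stack hno => exact (hσ.2 N List.mem_cons_self).isSolution hno
  | branch N stack i j hc =>
    obtain ⟨hN, hstack⟩ := List.forall_mem_cons.1 hσ.2
    refine ⟨hstack, by simp, ?_, by simp⟩
    simp only [List.forall_mem_cons, List.not_mem_nil, false_implies, implies_true, and_true]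
    exact ⟨hN.admissible.addOrder hc.1 (hN.not_transGen hc.symm),
      hN.admissible.addOrder hc.1.symm (hN.not_transGen hc)⟩
  | push stack ready l hl =>
    obtain ⟨h1, h2, -, h4⟩ := hσ
    refine ⟨fun h => h4 ?_ rfl, fun N hN => ?_⟩
    · rw [(List.append_eq_nil_iff.1 h).1] at hl
      exact hl.nil_eq.symm
    · exact (List.mem_append.1 hN).elim (fun h => h2 N (hl.mem_iff.1 h)) (h1 N)
  | generate stack ready o todo hac =>
    obtain ⟨h1, h2, h3, -⟩ := hσ
    obtain ⟨ho, htodo⟩ := List.forall_mem_cons.1 h3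
    exact ⟨h1, h2, htodo, ho, fun i P hP => absurd hP (by simp)⟩
  | cyclic stack ready o todo i hi => exact absurd hi ((hσ.2.2.1 o List.mem_cons_self).acyclic i)
  | call stack ready todo o pl i hi hj =>
    obtain ⟨h1, h2, h3, h4, h5⟩ := hσ
    exact ⟨h1, h2, h3, h4, h5, hi, hj, SIPPState.good_init⟩
  | inner stack ready todo o pl i s s' hs =>
    obtain ⟨h1, h2, h3, h4, h5, h6, h7, h8⟩ := hσ
    exact ⟨h1, h2, h3, h4, h5, h6, h7, hs.good hn hε (hε' i) hΔ h8⟩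
  | planned stack ready todo o pl i P =>
    obtain ⟨h1, h2, h3, h4, h5, h6, h7, h8⟩ := hσ
    exact ⟨h1, h2, h3, h4, h5.update h4 h6 h7 (h8.2 P rfl)⟩
  | discard stack ready todo o pl i =>
    obtain ⟨-, -, -, -, -, -, -, h8⟩ := hσ
    exact absurd rfl h8.1
  | generated stack ready todo o traj =>
    obtain ⟨h1, h2, h3, h4, h5⟩ := hσ
    refine ⟨h1, List.forall_mem_cons.2 ⟨⟨h4, fun i => (h5 i _ rfl).1, fun j i hji => ?_⟩, h2⟩, h3,
      by simp⟩
    obtain ⟨Q, hQ, hc⟩ := (h5 i _ rfl).2 j hji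
    cases hQ
    exact hc

theorem State.exists_step {σ : State ι} (hσ : σ.Good I n ε) (hsolved : ∀ traj, σ ≠ .solved traj) :
    ∃ σ', Step I n ε Δ σ σ' := by
  rcases σ with stack | ⟨stack, ready, todo⟩ | ⟨stack, ready, todo, o, pl⟩ |
    ⟨stack, ready, todo, o, pl, i, s⟩ | traj | _
  · rcases stack with _ | ⟨N, stack⟩
    · exact ⟨_, .fail⟩
    · by_cases h : ∀ i j, ¬ I.Collide N.traj i j
      · exact ⟨_, .success _ _ h⟩
      · push Not at h
        obtain ⟨i, j, h⟩ := h
        exact ⟨_, .branch _ _ i j h⟩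
  · rcases todo with _ | ⟨o, todo⟩
    · exact ⟨_, .push _ _ _ (List.Perm.refl _)⟩
    · exact ⟨_, .generate _ _ _ _ (hσ.2.2.1 o List.mem_cons_self).acyclic⟩
  · obtain ⟨-, -, -, ho, -⟩ := hσ
    by_cases h : ∃ i, pl i = none
    -- An acyclic priority order on finitely many agents is well-founded; a minimal unplanned agent
    -- can be planned next.
    · have : Std.Irrefl (Relation.TransGen o) := ⟨ho.acyclic⟩
      obtain ⟨i, hi, hmin⟩ :=
        (Finite.wellFounded_of_trans_of_irrefl (Relation.TransGen o)).has_min {i | pl i = none} h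
      exact ⟨_, .call _ _ _ _ _ i hi fun j hj hnone => hmin j hnone hj⟩
    · push Not at h
      choose traj htraj using fun i => Option.ne_none_iff_exists'.1 (h i)
      obtain rfl : pl = fun i => some (traj i) := funext htraj
      exact ⟨_, .generated _ _ _ _ _⟩
  · by_cases hs : ∃ r, s = .done r
    · obtain ⟨_ | P, rfl⟩ := hs
      exacts [⟨_, .discard _ _ _ _ _ _⟩, ⟨_, .planned _ _ _ _ _ _ _⟩]
    · push Not at hs
      obtain ⟨-, -, -, -, -, -, -, h8⟩ := hσ
      obtain ⟨s', hs'⟩ := SIPPState.exists_step (Δ := Δ) h8 hs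
      exact ⟨_, .inner _ _ _ _ _ _ _ _ hs'⟩
  · exact absurd rfl (hsolved traj)
  · exact hσ.elim

/-! ### Termination of Level 1. -/

/-- The converse of the step relation of PSB, restricted to states that satisfy the invariant. -/
def RevStep (I : Intersection V ι K) (n : ℕ) (ε Δ : ℝ) (σ' σ : State ι) : Prop :=
  σ.Good I n ε ∧ Step I n ε Δ σ σ'

open Classical in
theorem State.acc_plan (hε : 0 < ε) {stack ready : List (PTNode ι)} {todo : List (ι → ι → Prop)}
    {o : ι → ι → Prop} (hdiscard : Acc (RevStep I n ε Δ) (.siblings stack ready todo))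
    (hgenerated : ∀ traj, Acc (RevStep I n ε Δ) (.siblings stack (⟨o, traj⟩ :: ready) todo))
    (pl : ι → Option Profile) : Acc (RevStep I n ε Δ) (.plan stack ready todo o pl) := by
  induction hm : {i | pl i = none}.ncard using Nat.strong_induction_on generalizing pl with
  | _ m ih =>
    refine ⟨_, fun σ ⟨_, h⟩ => ?_⟩
    cases h with
    | generated => exact hgenerated _
    | call _ _ _ _ _ i hi =>
      have hlevel2 : ∀ s, Acc (RevStep I n ε Δ) (.level2 stack ready todo o pl i s) := by
        intro s
        induction SIPPState.acc (I := I) (n := n) (Δ := Δ) (i := i) (H := higher o pl i) hε s with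
        | intro s _ ihs =>
          refine ⟨_, fun σ ⟨_, h⟩ => ?_⟩
          cases h with
          | inner _ _ _ _ _ _ _ s' hs => exact ihs s' hs
          | discard => exact hdiscard
          | planned _ _ _ _ _ _ P =>
            refine ih _ ?_ _ rfl
            rw [← hm]
            refine Set.ncard_lt_ncard ⟨fun a ha => ?_, fun hsub => ?_⟩ (Set.toFinite _)
            · rcases eq_or_ne a i with rfl | hai
              · exact hi
              · rw [Set.mem_ofPred_eq, Function.update_of_ne hai] at ha
                exact ha
            · have := hsub hi
              rw [Set.mem_ofPred_eq, Function.update_self] at this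
              cases this
      exact hlevel2 _

/-- `hpush` allows for any sublist of the nodes still expected, which also covers skipped and
discarded orderings. -/
theorem State.acc_siblings (hε : 0 < ε) {stack : List (PTNode ι)} (todo : List (ι → ι → Prop))
    (ready : List (PTNode ι))
    (hpush : ∀ l : List (PTNode ι), (∀ N ∈ l, N ∈ ready ∨ N.order ∈ todo) →
      Acc (RevStep I n ε Δ) (.search (l ++ stack))) :
    Acc (RevStep I n ε Δ) (.siblings stack ready todo) := by
  induction todo generalizing ready with
  | nil =>
    refine ⟨_, fun σ ⟨_, h⟩ => ?_⟩
    cases h with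
    | push _ _ l hl => exact hpush l fun N hN => Or.inl (hl.mem_iff.1 hN)
  | cons o todo ih =>
    have hskip : Acc (RevStep I n ε Δ) (.siblings stack ready todo) :=
      ih ready fun l hl => hpush l fun N hN => (hl N hN).imp_right (List.mem_cons_of_mem _)
    refine ⟨_, fun σ ⟨_, h⟩ => ?_⟩
    cases h with
    | cyclic => exact hskip
    | generate =>
      refine State.acc_plan hε hskip (fun traj => ih _ fun l hl => hpush l fun N hN => ?_) _
      rcases hl N hN with h | h
      · rcases List.mem_cons.1 h with rfl | h
        exacts [Or.inr List.mem_cons_self, Or.inl h]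
      · exact Or.inr (List.mem_cons_of_mem _ h)

/-- PSB stops. -/
theorem State.acc_search (hε : 0 < ε) (stack : List (PTNode ι)) :
    Acc (RevStep I n ε Δ) (.search stack) := by
  induction hM : (stack : Multiset (PTNode ι)) using (InvImage.wf
    (fun N : PTNode ι => unordered N.order) Nat.lt_wfRel.wf).cutExpand.induction generalizing stack
    with
  | _ M ih =>
    subst hM
    refine ⟨_, fun σ ⟨hgood, h⟩ => ?_⟩
    cases h with
    | fail => exact ⟨_, fun σ ⟨hfailed, _⟩ => hfailed.elim⟩
    | success => exact ⟨_, fun σ ⟨_, h⟩ => nomatch h⟩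
    | branch N stack i j hc =>
      -- This is where the restriction to good states is needed: only there is a colliding pair
      -- known to be unordered, so that both children have a smaller measure.
      have hN := hgood.2 N List.mem_cons_self
      refine State.acc_siblings hε _ _ fun l hl => ih _ ⟨l, N, fun N' hN' => ?_, ?_⟩ _ rfl
      · change unordered N'.order < unordered N.order
        have := hl N' (Multiset.mem_coe.1 hN')
        simp only [List.not_mem_nil, List.mem_cons, false_or, or_false] at this
        rcases this with h | h <;> rw [h]
        exacts [unordered_addOrder_lt (hN.not_transGen hc),
          unordered_addOrder_lt (hN.not_transGen hc.symm)]
      · rw [← Multiset.coe_add, ← Multiset.cons_coe, ← Multiset.singleton_add]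
        abel

theorem not_exists_run (hn : 1 ≤ n) (hε : 0 < ε) (hε' : ∀ i, ε < I.length i / I.lo i 1)
    (hΔ : 0 < Δ) : ¬ ∃ run : ℕ → State ι, run 0 = State.init I ∧
      ∀ k, Step I n ε Δ (run k) (run (k + 1)) := by
  rintro ⟨run, h0, hrun⟩
  have hgood : ∀ k, (run k).Good I n ε := by
    intro k
    induction k with
    | zero => exact h0 ▸ State.good_init
    | succ k ih => exact (hrun k).good hn hε hε' hΔ ih
  have hacc : Acc (RevStep I n ε Δ) (run 0) := by
    rw [h0]
    exact State.acc_siblings hε _ _ fun l _ => State.acc_search hε _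
  -- An accessible state cannot lie on an infinite run.
  have hno : ∀ σ, Acc (RevStep I n ε Δ) σ → ∀ k, run k ≠ σ := by
    intro σ hσ
    induction hσ with
    | intro σ _ ih =>
      rintro k rfl
      exact ih _ ⟨hgood k, hrun k⟩ (k + 1) rfl
  exact hno _ hacc 0 rfl

end Level1

end PSB

theorem theorem2 {V ι : Type*} [Fintype ι] {K : ℕ} (I : PSB.Intersection V ι K)
    (n : ℕ) (hn : 1 ≤ n) (ε : ℝ) (hε : 0 < ε) (hε' : ∀ i, ε < I.length i / I.lo i 1)
    (Δ : ℝ) (hΔ : 0 < Δ) :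
    (¬ ∃ run : ℕ → PSB.State ι, run 0 = PSB.State.init I ∧
      ∀ k, PSB.Step I n ε Δ (run k) (run (k + 1))) ∧
    ∀ σ : PSB.State ι, Relation.ReflTransGen (PSB.Step I n ε Δ) (PSB.State.init I) σ →
      (∀ σ', ¬ PSB.Step I n ε Δ σ σ') →
      ∃ traj : ι → PSB.Profile, σ = PSB.State.solved traj ∧ I.IsSolution traj := by
  refine ⟨PSB.not_exists_run hn hε hε' hΔ, fun σ hσ hfinal => ?_⟩
  have hgood : σ.Good I n ε := by
    clear hfinal
    induction hσ with
    | refl => exact PSB.State.good_init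
    | tail _ h ih => exact h.good hn hε hε' hΔ ih
  by_contra hno
  obtain ⟨σ', hσ'⟩ := PSB.State.exists_step (Δ := Δ) hgood fun traj htraj => by
    subst htraj
    exact hno ⟨traj, rfl, hgood⟩
  exact hfinal σ' hσ'
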